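/- For every real $\varepsilon>0$ there are real constants $\varepsilon'>0$ and $C>0$, depending only on $\varepsilon$, such that the following holds for every real $X\ge 1$ and every set $\mathcal A$ of integers. Suppose that for each prime $p\le X^{1/2}$ the set $\mathcal A \bmod p$ of residue classes occupied by $\mathcal A$ is contained in an arithmetic progression $$S_p=\{a_p+i\,d_p : 0\le i<L_p\}\subset \mathbb Z/p\mathbb Z$$ of length at most $(1-\varepsilon)p$, that is, with $L_p$ a non-negative integer satisfying $L_p\le(1-\varepsilon)p$, where $a_p,d_p\in\mathbb Z/p\mathbb Z$ may depend on $p$. Then $$|\mathcal A[X]|\le C\,X^{1/2-\varepsilon'},\qquad\text{where } \mathcal A[X]:=\{n\in\mathcal A : 1\le n\le X\}.$$ -/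

import Mathlib

/-- The arithmetic progression `{a, a + d, …, a + (L - 1) d}` of length `L`, with first term `a`
and common difference `d`, in an additive commutative group. -/
def arithProg {G : Type*} [AddCommGroup G] (a d : G) (L : ℕ) : Set G :=
  {x | ∃ i : ℕ, i < L ∧ x = a + i • d}

/-- The reduction `𝒜 (mod p)`, the set of residue classes modulo `p` occupied by `𝒜`. -/
def reduceMod (A : Set ℤ) (p : ℕ) : Set (ZMod p) :=
  (fun n : ℤ => (n : ZMod p)) '' A

/-- `𝒜[X]`, the set of the elements `n` of `𝒜` with `1 ≤ n ≤ X` (a finite set). -/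
def initialPart (A : Set ℤ) (X : ℝ) : Set ℤ :=
  {n | n ∈ A ∧ 1 ≤ n ∧ (n : ℝ) ≤ X}

/-! A Fourier lower bound for the additive energy `E(B) = ∑ |B ∩ (B + h)|²` is played against a
sieve upper bound, and the upper bound is iterated.

Lower bound: after dilation by the inverse of the common difference, the residues of `B` modulo `p`
avoid an interval of proportion about `ε`. Testing against a Fejér kernel centred in that gap gives
a nonzero frequency `k/p` where the exponential sum is `≫ |B|` (`exists_large_expSum`). These
fractions, one per prime `p ≤ √X` outside a bounded set, are `1/X`-separated, so the fourth moment
over a grid of `≍ X` points, which is the energy, yields `E(B) ≫ |B|⁴ / (√X log X)`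
(`exists_energy_ge`).

Upper bound: measure `B` by its occupancy, the weighted proportion of classes it meets modulo primes
up to `X^(9/20)`. If this is at most `3/8` of the maximum, the larger sieve gives `|B| ≪ X^(9/20)`.
Otherwise, a subset of `ℤ/pℤ` of density between `1/4` and `1 - ε` has few near-periods
(Cauchy–Davenport), so by the larger sieve only `O(X^(9/20))` shifts `h` nearly preserve `B` modulo
many primes. For every other `h`, the set `B ∩ (B + h)` is still confined and its occupancy is
smaller by a fixed proportion; induction bounds it by `X^(1/2 - δ)`. Hence `E(B) ≪ X^(1/2 - δ)
|B|²`, and comparison gives `|B|² ≪ X^(1 - δ) log X`. The number of rounds depends only on `ε`. -/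

open Finset

/-! ### The larger sieve and a Mertens estimate. -/

/-- Cauchy–Schwarz bound for the number of collisions of a map on a finite set. -/
theorem card_sq_le_card_image_mul_collisions {α β : Type*} [DecidableEq β]
    (B : Finset α) (f : α → β) :
    (#B : ℝ) ^ 2 ≤ #(B.image f) * #((B ×ˢ B).filter fun x => f x.1 = f x.2) := by
  classical
  have h1 : #B = ∑ a ∈ B.image f, #(B.filter fun x => f x = a) :=
    card_eq_sum_card_image f B
  have h2 : #((B ×ˢ B).filter fun x => f x.1 = f x.2)
      = ∑ a ∈ B.image f, #(B.filter fun x => f x = a) ^ 2 := by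
    rw [card_eq_sum_card_fiberwise (f := fun x => f x.1) (t := B.image f)]
    · refine sum_congr rfl fun a _ => ?_
      rw [sq, ← card_product]
      congr 1
      ext ⟨x, y⟩
      simp only [mem_filter, mem_product]
      constructor
      · rintro ⟨⟨⟨hx, hy⟩, h⟩, h'⟩
        exact ⟨⟨hx, h'⟩, hy, h ▸ h'⟩
      · rintro ⟨⟨hx, h⟩, hy, h'⟩
        exact ⟨⟨⟨hx, hy⟩, h.trans h'.symm⟩, h⟩
    · intro x hx
      rw [mem_coe, mem_filter, mem_product] at hx
      exact mem_coe.2 (mem_image_of_mem f hx.1.1)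
  have h3 := sq_sum_le_card_mul_sum_sq (s := B.image f)
    (f := fun a => (#(B.filter fun x => f x = a) : ℝ))
  rw [h1, h2]
  push_cast
  exact h3

theorem sum_log_primes_dvd_le {P : Finset ℕ} (hP : ∀ p ∈ P, p.Prime) {n : ℕ} (hn : n ≠ 0) :
    ∑ p ∈ P.filter (· ∣ n), Real.log p ≤ Real.log n := by
  rw [← Real.log_prod (fun p hp => by
    have := (hP p (mem_filter.1 hp).1).pos
    positivity)]
  have hd : ∏ p ∈ P.filter (· ∣ n), p ∣ n :=
    prod_primes_dvd n (fun p hp => (hP p (mem_filter.1 hp).1).prime)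
      (fun p hp => (mem_filter.1 hp).2)
  have hpos : 0 < ∏ p ∈ P.filter (· ∣ n), p :=
    prod_pos fun p hp => (hP p (mem_filter.1 hp).1).pos
  rw [← Nat.cast_prod]
  exact Real.log_le_log (by exact_mod_cast hpos)
    (by exact_mod_cast Nat.le_of_dvd (Nat.pos_of_ne_zero hn) hd)

/-- Gallagher's larger sieve, in terms of collisions. -/
theorem larger_sieve {B : Finset ℤ} {Y : ℝ} (hY : 1 ≤ Y)
    (hB : ∀ m ∈ B, ∀ n ∈ B, |((m - n : ℤ) : ℝ)| ≤ Y) {P : Finset ℕ} (hP : ∀ p ∈ P, p.Prime) :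
    ∑ p ∈ P, Real.log p * #((B ×ˢ B).filter fun x => (x.1 : ZMod p) = (x.2 : ZMod p))
      ≤ #B * ∑ p ∈ P, Real.log p + (#B : ℝ) ^ 2 * Real.log Y := by
  have hlog : ∀ p ∈ P, 0 ≤ Real.log p := fun p _ => Real.log_natCast_nonneg p
  -- A nonzero difference has prime divisors of total logarithm at most `log Y`, whereas a diagonal
  -- pair collides modulo every prime.
  have key : ∀ x ∈ B ×ˢ B,
      ∑ p ∈ P, (if (x.1 : ZMod p) = (x.2 : ZMod p) then Real.log p else 0)
        ≤ (if x.1 = x.2 then ∑ p ∈ P, Real.log p else 0) + Real.log Y := by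
    intro x hx
    rw [mem_product] at hx
    split_ifs with h
    · rw [h]
      simpa using Real.log_nonneg hY
    · rw [zero_add, ← sum_filter]
      have hne : (x.1 - x.2).natAbs ≠ 0 := by
        rw [Int.natAbs_ne_zero]; exact sub_ne_zero.2 h
      have e : P.filter (fun p => (x.1 : ZMod p) = (x.2 : ZMod p))
          = P.filter (· ∣ (x.1 - x.2).natAbs) := by
        refine filter_congr fun p _ => ?_
        rw [← Int.natCast_dvd, ← ZMod.intCast_eq_intCast_iff_dvd_sub, eq_comm]
      rw [e]
      refine (sum_log_primes_dvd_le hP hne).trans (Real.log_le_log ?_ ?_)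
      · exact_mod_cast Nat.pos_of_ne_zero hne
      · rw [Nat.cast_natAbs, Int.cast_abs]
        exact hB _ hx.1 _ hx.2
  calc ∑ p ∈ P, Real.log p * #((B ×ˢ B).filter fun x => (x.1 : ZMod p) = (x.2 : ZMod p))
      = ∑ x ∈ B ×ˢ B, ∑ p ∈ P, (if (x.1 : ZMod p) = (x.2 : ZMod p) then Real.log p else 0) := by
        rw [sum_comm]
        refine sum_congr rfl fun p _ => ?_
        rw [← sum_filter, sum_const, nsmul_eq_mul, mul_comm]
    _ ≤ ∑ x ∈ B ×ˢ B, ((if x.1 = x.2 then ∑ p ∈ P, Real.log p else 0) + Real.log Y) :=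
        sum_le_sum key
    _ = _ := by
        rw [sum_add_distrib, sum_const, card_product, sum_product]
        simp [sq]

/-- A lower bound of Mertens type for `∑ log p / p`. -/
theorem exists_log_sub_le_sum_log_div :
    ∃ C : ℝ, ∀ n : ℕ, 1 ≤ n →
      Real.log n - C ≤ ∑ p ∈ (Finset.range (n + 1)).filter Nat.Prime, Real.log p / p := by
  have hs : Summable fun n : ℕ => 4 / (n : ℝ) ^ (3 / 2 : ℝ) := by
    simpa [div_eq_mul_inv] using
      (Real.summable_nat_rpow_inv.2 (by norm_num : (1 : ℝ) < 3 / 2)).mul_left 4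
  refine ⟨1 + ∑' n : ℕ, 4 / (n : ℝ) ^ (3 / 2 : ℝ), fun n hn => ?_⟩
  have hn0 : (0 : ℝ) < n := by exact_mod_cast hn
  set P := (Finset.range (n + 1)).filter Nat.Prime with hPdef
  have hP : ∀ p ∈ P, p.Prime := fun p hp => (mem_filter.1 hp).2
  have h1 : (n : ℝ) * Real.log n - n ≤ Real.log (n.factorial) := by
    have := Real.pow_div_factorial_le_exp (n : ℝ) (Nat.cast_nonneg n) n
    have hf : (0 : ℝ) < n.factorial := by exact_mod_cast n.factorial_pos
    have h2 := Real.log_le_log (by positivity) this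
    rw [Real.log_exp, Real.log_div (by positivity) hf.ne', Real.log_pow] at h2
    linarith
  have h2 : Real.log (n.factorial) = ∑ p ∈ P, (n.factorial.factorization p : ℝ) * Real.log p := by
    conv_lhs => rw [← Nat.prod_factorization_pow_eq_self n.factorial_ne_zero]
    rw [Finsupp.prod, Nat.cast_prod, Real.log_prod]
    · rw [Nat.support_factorization]
      have : n.factorial.primeFactors = P := by
        ext p
        simp only [Nat.mem_primeFactors, hPdef, mem_filter, mem_range, Nat.lt_succ_iff]
        constructor
        · rintro ⟨hp, hd, -⟩
          exact ⟨(hp.dvd_factorial).1 hd, hp⟩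
        · rintro ⟨hle, hp⟩
          exact ⟨hp, (hp.dvd_factorial).2 hle, n.factorial_ne_zero⟩
      rw [this]
      refine sum_congr rfl fun p _ => ?_
      rw [Nat.cast_pow, Real.log_pow]
    · intro p hp
      have := (Nat.prime_of_mem_primeFactors (Nat.support_factorization _ ▸ hp)).pos
      positivity
  -- Legendre gives `v_p(n!) ≤ n / (p - 1)`; replacing `p - 1` by `p` costs a summable error.
  have h3 : ∀ p ∈ P, (n.factorial.factorization p : ℝ) * Real.log p
      ≤ n * (Real.log p / p + 4 / (p : ℝ) ^ (3 / 2 : ℝ)) := by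
    intro p hp
    have hpp := hP p hp
    have := Fact.mk hpp
    have hp2 : (2 : ℝ) ≤ p := by exact_mod_cast hpp.two_le
    have hv : ((p : ℝ) - 1) * n.factorial.factorization p ≤ n := by
      have := sub_one_mul_padicValNat_factorial (p := p) n
      have h' : (p - 1) * n.factorial.factorization p ≤ n := by
        rw [Nat.factorization_def _ hpp, this]; exact Nat.sub_le _ _
      have h'' : (((p - 1 : ℕ) : ℝ)) * n.factorial.factorization p ≤ n := by exact_mod_cast h'
      rwa [Nat.cast_sub hpp.one_le, Nat.cast_one] at h''
    have hlog : 0 ≤ Real.log p := Real.log_natCast_nonneg p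
    have hl2 : Real.log p ≤ 2 * (p : ℝ) ^ (1 / 2 : ℝ) := by
      have := Real.log_le_rpow_div (x := p) (by positivity) (by norm_num : (0 : ℝ) < 1 / 2)
      linarith
    have hpow : (p : ℝ) ^ (3 / 2 : ℝ) * (p : ℝ) ^ (1 / 2 : ℝ) = p * p := by
      rw [← Real.rpow_add (by positivity)]
      norm_num [sq]
    have hA : (n.factorial.factorization p : ℝ) * Real.log p
        ≤ n / (p - 1) * Real.log p := by
      refine mul_le_mul_of_nonneg_right ?_ hlog
      rw [le_div_iff₀ (by linarith)]
      linarith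
    refine hA.trans ?_
    have hB : Real.log p / ((p : ℝ) - 1) ≤ Real.log p / p + 4 / (p : ℝ) ^ (3 / 2 : ℝ) := by
      have e1 : Real.log p / ((p : ℝ) - 1) = Real.log p / p + Real.log p / (p * (p - 1)) := by
        have : (p : ℝ) - 1 ≠ 0 := by linarith
        field_simp
        ring
      rw [e1]
      refine add_le_add_right ?_ _
      have hq : (0 : ℝ) < (p : ℝ) ^ (3 / 2 : ℝ) := by positivity
      have hr : (0 : ℝ) < (p : ℝ) ^ (1 / 2 : ℝ) := by positivity
      rw [div_le_div_iff₀ (by nlinarith) hq]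
      calc Real.log p * (p : ℝ) ^ (3 / 2 : ℝ)
          ≤ 2 * (p : ℝ) ^ (1 / 2 : ℝ) * (p : ℝ) ^ (3 / 2 : ℝ) := by gcongr
        _ = 2 * (p * p) := by rw [← hpow]; ring
        _ ≤ 4 * (p * (p - 1)) := by nlinarith
    calc (n : ℝ) / (p - 1) * Real.log p = n * (Real.log p / ((p : ℝ) - 1)) := by ring
      _ ≤ _ := by gcongr
  have h4 : (n : ℝ) * Real.log n - n
      ≤ n * (∑ p ∈ P, Real.log p / p + ∑' n : ℕ, 4 / (n : ℝ) ^ (3 / 2 : ℝ)) := by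
    calc (n : ℝ) * Real.log n - n ≤ ∑ p ∈ P, (n.factorial.factorization p : ℝ) * Real.log p := by
          rw [← h2]; exact h1
      _ ≤ ∑ p ∈ P, (n * (Real.log p / p + 4 / (p : ℝ) ^ (3 / 2 : ℝ)) : ℝ) := sum_le_sum h3
      _ = n * (∑ p ∈ P, Real.log p / p + ∑ p ∈ P, 4 / (p : ℝ) ^ (3 / 2 : ℝ)) := by
          rw [← mul_sum, sum_add_distrib]
      _ ≤ _ := by
          gcongr
          exact hs.sum_le_tsum P fun i _ => by positivity
  have h5 : Real.log n - 1
      ≤ ∑ p ∈ P, Real.log p / p + ∑' n : ℕ, 4 / (n : ℝ) ^ (3 / 2 : ℝ) := by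
    refine le_of_mul_le_mul_left ?_ hn0
    linarith
  linarith

/-! ### Near-periods of subsets of `ℤ/pℤ`. -/

/-- The number of elements of `S` that leave `S` under translation by `-h`. -/
def shiftDefect {G : Type*} [AddCommGroup G] [DecidableEq G] (S : Finset G) (h : G) : ℕ :=
  #(S.filter fun x => x - h ∉ S)

section shiftDefect

variable {G : Type*} [AddCommGroup G] [DecidableEq G]

/-- If `x` leaves `S` under `-(g + h)`, then either `x` already leaves under `-g`, or `x - g` lies
in `S` and leaves under `-h`. Near-periods can therefore be added. -/
theorem shiftDefect_add_le (S : Finset G) (g h : G) :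
    shiftDefect S (g + h) ≤ shiftDefect S g + shiftDefect S h := by
  unfold shiftDefect
  have hsub : S.filter (fun x => x - (g + h) ∉ S)
      ⊆ S.filter (fun x => x - g ∉ S) ∪ (S.filter (fun x => x - h ∉ S)).image (· + g) := by
    intro x hx
    rw [mem_filter] at hx
    rw [mem_union, mem_filter, mem_image]
    by_cases hg : x - g ∈ S
    · right
      refine ⟨x - g, mem_filter.2 ⟨hg, ?_⟩, by simp⟩
      rw [sub_sub]
      exact hx.2
    · exact Or.inl ⟨hx.1, hg⟩
  exact (card_le_card hsub).trans ((card_union_le _ _).trans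
    (Nat.add_le_add_left card_image_le _))

theorem card_filter_sub_mem (S : Finset G) (h : G) :
    #(S.filter fun x => x - h ∈ S) + shiftDefect S h = #S :=
  card_filter_add_card_filter_not _

/-- Double counting: each `x ∈ S` is carried out of `S` by exactly `|G| - |S|` translations. -/
theorem sum_shiftDefect [Fintype G] (S : Finset G) :
    ∑ h : G, shiftDefect S h = #S * (Fintype.card G - #S) := by
  have h1 : ∀ x ∈ S, #((univ : Finset G).filter fun h => x - h ∉ S) = Fintype.card G - #S := by
    intro x _
    rw [← card_compl]
    refine card_bij (fun h _ => x - h) ?_ ?_ ?_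
    · intro h hh
      simpa using hh
    · intro a _ b _ hab
      exact sub_right_injective hab
    · intro b hb
      exact ⟨x - b, by simpa using hb, by simp⟩
  simp only [shiftDefect, card_filter]
  rw [sum_comm]
  simp only [← card_filter]
  rw [sum_congr rfl h1, sum_const, smul_eq_mul]

end shiftDefect

/-- In `ZMod p`, if many `h` nearly preserve `S`, then all `h` do so to some extent. -/
theorem exists_sumset_small_defect {p : ℕ} (hp : p.Prime) (S T : Finset (ZMod p)) (hT : 2 ≤ #T)
    {t : ℝ} (ht : ∀ h ∈ T, (shiftDefect S h : ℝ) ≤ t) (n : ℕ) :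
    ∃ U : Finset (ZMod p), min p (n * (#T - 1) + 1) ≤ #U ∧
      ∀ h ∈ U, (shiftDefect S h : ℝ) ≤ n * t := by
  have := Fact.mk hp
  induction n with
  | zero =>
    refine ⟨{0}, by simp, ?_⟩
    simp [shiftDefect]
  | succ n ih =>
    obtain ⟨U, hU, hd⟩ := ih
    open scoped Pointwise in
    refine ⟨U + T, ?_, ?_⟩
    · have hUne : U.Nonempty := by
        rw [← card_pos]
        refine lt_of_lt_of_le ?_ hU
        have := hp.pos
        omega
      have hTne : T.Nonempty := by rw [← card_pos]; omega
      have := ZMod.cauchy_davenport hp hUne hTne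
      refine le_trans ?_ this
      rw [add_mul, one_mul]
      omega
    · intro h hh
      obtain ⟨u, hu, v, hv, rfl⟩ := Finset.mem_add.1 hh
      have h1 : (shiftDefect S (u + v) : ℝ) ≤ shiftDefect S u + shiftDefect S v := by
        exact_mod_cast shiftDefect_add_le S u v
      have h2 := hd u hu
      have h3 := ht v hv
      push_cast
      linarith

/-- A set of middling density in `ZMod p` is nearly preserved by few translations only. -/
theorem card_small_shiftDefect_le {p : ℕ} (hp : p.Prime) (hp2 : 2000 < p) {ε : ℝ} (hε : 0 < ε)
    {S : Finset (ZMod p)} (h1 : (p : ℝ) / 4 ≤ #S) (h2 : (#S : ℝ) ≤ (1 - ε) * p)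
    {T : Finset (ZMod p)} (hT : ∀ h ∈ T, (shiftDefect S h : ℝ) < ε / 8000 * p) :
    (#T : ℝ) ≤ p / 1000 := by
  have := Fact.mk hp
  by_contra! hcard
  have hpR : (2000 : ℝ) < p := by exact_mod_cast hp2
  have hT2 : 2 ≤ #T := by
    have : (2 : ℝ) < #T := by linarith
    exact_mod_cast this.le
  -- a strict upper bound attained uniformly
  obtain ⟨t, ht0, ht1, ht2⟩ : ∃ t : ℝ, 0 ≤ t ∧ t < ε / 8000 * p ∧
      ∀ h ∈ T, (shiftDefect S h : ℝ) ≤ t := by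
    obtain ⟨h0, hh0, hmax⟩ := exists_max_image T (fun h => (shiftDefect S h : ℝ))
      (card_pos.1 (by omega))
    exact ⟨_, Nat.cast_nonneg _, hT h0 hh0, hmax⟩
  -- Since `#T ≥ 2` and `1000 * #T > p`, one has `2000 * (#T - 1) ≥ 1000 * #T > p`, so the 2000-fold
  -- sumset is everything. All defects are then at most `2000 * t < ε * p / 4`, while their mean is
  -- at least `ε * p / 4`.
  obtain ⟨U, hU, hd⟩ := exists_sumset_small_defect hp S T hT2 ht2 2000
  have hUuniv : U = univ := by
    rw [← card_eq_iff_eq_univ, ZMod.card]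
    refine le_antisymm ((card_le_univ U).trans_eq (ZMod.card p)) ?_
    refine le_trans ?_ hU
    have : p < 1000 * #T := by
      have : (p : ℝ) < 1000 * #T := by linarith
      exact_mod_cast this
    omega
  have hsum := sum_shiftDefect S
  have hSp : #S ≤ p := (card_le_univ S).trans_eq (ZMod.card p)
  have hle : (∑ h : ZMod p, (shiftDefect S h : ℝ)) ≤ p * (2000 * t) := by
    calc (∑ h : ZMod p, (shiftDefect S h : ℝ)) ≤ ∑ _h : ZMod p, (2000 * t) :=
          sum_le_sum fun h _ => by simpa using hd h (hUuniv ▸ mem_univ h)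
      _ = _ := by rw [sum_const, card_univ, ZMod.card, nsmul_eq_mul]
  have heq : (∑ h : ZMod p, (shiftDefect S h : ℝ)) = #S * (p - #S) := by
    rw [← Nat.cast_sum, hsum, ZMod.card, Nat.cast_mul, Nat.cast_sub hSp]
  rw [heq] at hle
  have h3 : (p : ℝ) / 4 * (ε * p) ≤ #S * (p - #S) := by
    refine mul_le_mul h1 (by linarith) (by positivity) (by positivity)
  nlinarith

/-! ### Exponential sums and the fourth moment. -/

/-- The additive character `x ↦ e^{2πix}` of the real line. -/
noncomputable def expTwoPi (x : ℝ) : ℂ := Complex.exp ((2 * Real.pi * x : ℝ) * Complex.I)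

theorem expTwoPi_add (x y : ℝ) : expTwoPi (x + y) = expTwoPi x * expTwoPi y := by
  rw [expTwoPi, expTwoPi, expTwoPi, ← Complex.exp_add]
  congr 1
  push_cast
  ring

@[simp] theorem expTwoPi_zero : expTwoPi 0 = 1 := by simp [expTwoPi]

@[simp] theorem norm_expTwoPi (x : ℝ) : ‖expTwoPi x‖ = 1 := Complex.norm_exp_ofReal_mul_I _

theorem expTwoPi_int (n : ℤ) : expTwoPi n = 1 := by
  rw [expTwoPi, Complex.exp_eq_one_iff]
  exact ⟨n, by push_cast; ring⟩

theorem expTwoPi_eq_one_iff {x : ℝ} : expTwoPi x = 1 ↔ ∃ n : ℤ, x = n := by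
  rw [expTwoPi, Complex.exp_eq_one_iff]
  refine exists_congr fun n => ?_
  have hpi : (2 * Real.pi * Complex.I : ℂ) ≠ 0 := Complex.two_pi_I_ne_zero
  rw [show ((2 * Real.pi * x : ℝ) * Complex.I : ℂ) = x * (2 * Real.pi * Complex.I) by
    push_cast; ring]
  rw [mul_left_inj' hpi]
  exact_mod_cast Iff.rfl

theorem expTwoPi_nat_mul (n : ℕ) (x : ℝ) : expTwoPi (n * x) = expTwoPi x ^ n := by
  rw [expTwoPi, expTwoPi, ← Complex.exp_nat_mul]
  congr 1
  push_cast
  ring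

theorem conj_expTwoPi (x : ℝ) : (starRingEnd ℂ) (expTwoPi x) = expTwoPi (-x) := by
  rw [expTwoPi, expTwoPi, ← Complex.exp_conj, map_mul, Complex.conj_ofReal, Complex.conj_I]
  congr 1
  push_cast
  ring

theorem norm_expTwoPi_sub_le (x y : ℝ) : ‖expTwoPi x - expTwoPi y‖ ≤ 2 * Real.pi * |x - y| := by
  have h : expTwoPi x - expTwoPi y = expTwoPi y * (expTwoPi (x - y) - 1) := by
    rw [mul_sub, ← expTwoPi_add]; simp
  rw [h, norm_mul, norm_expTwoPi, one_mul, expTwoPi, mul_comm _ Complex.I]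
  refine (Real.norm_exp_I_mul_ofReal_sub_one_le).trans ?_
  rw [Real.norm_eq_abs, abs_mul, abs_of_pos (by positivity : (0 : ℝ) < 2 * Real.pi)]

/-- The exponential sum of a finite set of integers. -/
noncomputable def expSum (B : Finset ℤ) (θ : ℝ) : ℂ := ∑ n ∈ B, expTwoPi (n * θ)

theorem sum_range_expTwoPi {N : ℕ} (hN : 0 < N) (m : ℤ) :
    ∑ t ∈ range N, expTwoPi (m * (t / N)) = if (N : ℤ) ∣ m then (N : ℂ) else 0 := by
  have hNR : (N : ℝ) ≠ 0 := by positivity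
  have e : ∀ t : ℕ, expTwoPi (m * (t / N)) = expTwoPi (m / N) ^ t := fun t => by
    rw [← expTwoPi_nat_mul]
    congr 1
    ring
  simp only [e]
  have hpow : expTwoPi (m / N) ^ N = 1 := by
    rw [← expTwoPi_nat_mul, mul_div_cancel₀ _ hNR, expTwoPi_int]
  have hone : expTwoPi (m / N) = 1 ↔ (N : ℤ) ∣ m := by
    rw [expTwoPi_eq_one_iff]
    refine exists_congr fun k => ?_
    rw [div_eq_iff hNR, mul_comm]
    exact_mod_cast Iff.rfl
  split_ifs with h
  · rw [hone.2 h]; simp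
  · have hne : expTwoPi (m / N) ≠ 1 := fun h' => h (hone.1 h')
    rw [geom_sum_eq hne, hpow, sub_self, zero_div]

/-- Parseval's identity on `ℤ/Nℤ`. -/
theorem sum_range_norm_sq_eq {N : ℕ} (hN : 0 < N) (H : Finset ℤ)
    (hH : ∀ g ∈ H, ∀ h ∈ H, (N : ℤ) ∣ g - h → g = h) (a : ℤ → ℝ) :
    ∑ t ∈ range N, ‖∑ h ∈ H, (a h : ℂ) * expTwoPi (h * (t / N))‖ ^ 2
      = N * ∑ h ∈ H, a h ^ 2 := by
  rw [← Complex.ofReal_inj]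
  push_cast
  have e : ∀ t : ℕ, ((‖∑ h ∈ H, (a h : ℂ) * expTwoPi (h * (t / N))‖ : ℂ)) ^ 2
      = ∑ g ∈ H, ∑ h ∈ H, (a g : ℂ) * a h * expTwoPi (((g - h : ℤ) : ℝ) * (t / N)) := by
    intro t
    rw [← Complex.mul_conj', map_sum, sum_mul_sum]
    refine sum_congr rfl fun g _ => sum_congr rfl fun h _ => ?_
    rw [map_mul, Complex.conj_ofReal, conj_expTwoPi]
    have : ((g - h : ℤ) : ℝ) * (t / N) = g * (t / N) + -(h * (t / N)) := by push_cast; ring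
    rw [this, expTwoPi_add]
    ring
  simp only [e]
  rw [sum_comm, mul_sum]
  refine sum_congr rfl fun g hg => ?_
  rw [sum_comm]
  simp only [← mul_sum, sum_range_expTwoPi hN]
  rw [sum_eq_single_of_mem g hg]
  · simp; ring
  · intro h hh hne
    rw [if_neg fun hd => hne (hH g hg h hh hd).symm, mul_zero]

/-- The differences of a finite set of integers. -/
def diffs (B : Finset ℤ) : Finset ℤ := (B ×ˢ B).image fun x => x.1 - x.2

/-- `B ∩ (B + h)`. -/
def interShift (B : Finset ℤ) (h : ℤ) : Finset ℤ := B.filter fun n => n - h ∈ B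

theorem card_fiber_diffs (B : Finset ℤ) (h : ℤ) :
    #((B ×ˢ B).filter fun x => x.1 - x.2 = h) = #(interShift B h) := by
  refine card_bij' (fun x _ => x.1) (fun n _ => (n, n - h)) ?_ ?_ ?_ ?_
  · rintro ⟨m, n⟩ hx
    simp only [mem_filter, mem_product] at hx
    obtain ⟨⟨hm, hn⟩, rfl⟩ := hx
    simp [interShift, hm, hn]
  · intro n hn
    simp only [interShift, mem_filter] at hn
    simp [hn.1, hn.2]
  · rintro ⟨m, n⟩ hx
    simp only [mem_filter, mem_product] at hx
    simp [← hx.2]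
  · intro n _
    rfl

theorem sum_card_interShift (B : Finset ℤ) : ∑ h ∈ diffs B, #(interShift B h) = #B ^ 2 := by
  rw [sq, ← card_product, card_eq_sum_card_image fun x : ℤ × ℤ => x.1 - x.2]
  exact sum_congr rfl fun h _ => (card_fiber_diffs B h).symm

theorem norm_expSum_sq (B : Finset ℤ) (θ : ℝ) :
    ((‖expSum B θ‖ ^ 2 : ℝ) : ℂ)
      = ∑ h ∈ diffs B, ((#(interShift B h) : ℝ) : ℂ) * expTwoPi (h * θ) := by
  have h1 : ((‖expSum B θ‖ ^ 2 : ℝ) : ℂ)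
      = ∑ x ∈ B ×ˢ B, expTwoPi (((x.1 - x.2 : ℤ) : ℝ) * θ) := by
    push_cast
    rw [← Complex.mul_conj', expSum, map_sum, sum_mul_sum, sum_product]
    refine sum_congr rfl fun g _ => sum_congr rfl fun h _ => ?_
    rw [conj_expTwoPi, ← expTwoPi_add]
    congr 1
    push_cast
    ring
  rw [h1, ← sum_fiberwise_of_maps_to (g := fun x : ℤ × ℤ => x.1 - x.2) (t := diffs B)
    (fun x hx => mem_image_of_mem _ hx)]
  refine sum_congr rfl fun h _ => ?_
  rw [← card_fiber_diffs, sum_congr rfl (g := fun _ => expTwoPi (h * θ))]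
  · simp
  · intro x hx
    rw [(mem_filter.1 hx).2]

/-- The fourth moment of an exponential sum over `ℤ/Nℤ` is `N` times the additive energy. -/
theorem sum_norm_expSum_pow_four {B : Finset ℤ} {N : ℕ} (hN : 0 < N)
    (hB : ∀ m ∈ B, ∀ n ∈ B, 2 * |m - n| < N) :
    ∑ t ∈ range N, ‖expSum B (t / N)‖ ^ 4 = N * ∑ h ∈ diffs B, (#(interShift B h) : ℝ) ^ 2 := by
  -- Parseval is applied to `‖expSum B ·‖²`, whose Fourier coefficients are the `#(interShift B h)`.
  rw [← sum_range_norm_sq_eq hN (diffs B) ?_ fun h => (#(interShift B h) : ℝ)]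
  · refine sum_congr rfl fun t _ => ?_
    rw [← norm_expSum_sq, Complex.norm_real, norm_pow, norm_norm]
    ring
  · have key : ∀ g ∈ diffs B, 2 * |g| < N := by
      intro g hg
      obtain ⟨x, hx, rfl⟩ := mem_image.1 hg
      rw [mem_product] at hx
      exact hB _ hx.1 _ hx.2
    intro g hg h hh hd
    have := Int.eq_zero_of_abs_lt_dvd hd (by
      have h1 := key g hg
      have h2 := key h hh
      have h3 := abs_sub g h
      omega)
    omega

/-! ### Fourier bias of sets confined to progressions. -/

theorem expTwoPi_div_eq_of_intCast_eq {p : ℕ} (hp : 0 < p) {x y : ℤ}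
    (h : (x : ZMod p) = (y : ZMod p)) : expTwoPi (x / p) = expTwoPi (y / p) := by
  obtain ⟨k, hk⟩ := (ZMod.intCast_eq_intCast_iff_dvd_sub x y p).1 h
  have hpR : (p : ℝ) ≠ 0 := by positivity
  have hy : (y : ℝ) / p = x / p + k := by
    have : (y : ℝ) - x = p * k := by exact_mod_cast hk
    field_simp
    linarith
  rw [hy, expTwoPi_add, expTwoPi_int, mul_one]

theorem norm_expTwoPi_sub_one (u : ℝ) : ‖expTwoPi u - 1‖ = 2 * |Real.sin (Real.pi * u)| := by
  rw [expTwoPi, mul_comm _ Complex.I, Complex.norm_exp_I_mul_ofReal_sub_one, norm_mul,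
    Real.norm_eq_abs, Real.norm_eq_abs, abs_two]
  congr 3
  ring

theorem le_sin_pi_mul {ε u : ℝ} (h1 : ε / 2 ≤ u) (h0 : 0 ≤ u) (h2 : u ≤ 1 - ε / 2) (h3 : u ≤ 1) :
    ε ≤ Real.sin (Real.pi * u) := by
  have hpi := Real.pi_pos
  have aux : ∀ v : ℝ, 0 ≤ v → v ≤ 1 / 2 → 2 * v ≤ Real.sin (Real.pi * v) := by
    intro v hv0 hv1
    have := Real.mul_le_sin (x := Real.pi * v) (by positivity) (by nlinarith)
    calc 2 * v = 2 / Real.pi * (Real.pi * v) := by field_simp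
      _ ≤ _ := this
  rcases le_total u (1 / 2) with h | h
  · linarith [aux u h0 h]
  · have h4 := aux (1 - u) (by linarith) (by linarith)
    rw [show Real.pi * (1 - u) = Real.pi - Real.pi * u by ring, Real.sin_pi_sub] at h4
    linarith

/-- A geometric sum: `u` stays `ε / 2` away from the integers, so the denominator is at least `2 *
ε` and the numerator at most `2`. -/
theorem norm_sum_range_expTwoPi_le {ε u : ℝ} (hε : 0 < ε) (h1 : ε / 2 ≤ u) (h2 : u ≤ 1 - ε / 2)
    (K : ℕ) : ‖∑ j ∈ range K, expTwoPi (j * u)‖ ≤ 1 / ε := by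
  have hs := le_sin_pi_mul h1 (by linarith) h2 (by linarith)
  have hge : 2 * ε ≤ ‖expTwoPi u - 1‖ := by
    rw [norm_expTwoPi_sub_one]
    linarith [le_abs_self (Real.sin (Real.pi * u))]
  have hne : expTwoPi u ≠ 1 := by
    intro h
    rw [h, sub_self, norm_zero] at hge
    linarith
  simp only [expTwoPi_nat_mul]
  rw [geom_sum_eq hne, norm_div, div_le_div_iff₀ (by linarith) hε]
  have : ‖expTwoPi u ^ K - 1‖ ≤ 2 := by
    refine (norm_sub_le _ _).trans ?_
    rw [norm_pow, norm_expTwoPi, norm_one]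
    norm_num
  nlinarith

/-- A set of integers confined modulo `p` to a short arithmetic progression has a large
exponential sum at some fraction with denominator `p`. -/
theorem exists_large_expSum {p : ℕ} (hp : p.Prime) {ε : ℝ} (hε : 0 < ε) {K : ℕ}
    (hK : 4 / ε ^ 2 ≤ K) (hKp : K < p) {B : Finset ℤ} {a d : ZMod p} {L : ℕ}
    (hL : (L : ℝ) ≤ (1 - ε) * p) (hB : ∀ n ∈ B, ∃ i < L, (n : ZMod p) = a + i • d) :
    ∃ k : ℕ, 0 < k ∧ k < p ∧ (#B : ℝ) / (2 * K) ≤ ‖expSum B (k / p)‖ := by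
  have := Fact.mk hp
  have hK0 : 0 < K := by
    have : (0 : ℝ) < K := lt_of_lt_of_le (by positivity) hK
    exact_mod_cast this
  have hp0 : (0 : ℝ) < p := by exact_mod_cast hp.pos
  have hKR : (0 : ℝ) < K := by exact_mod_cast hK0
  -- If `d = 0` only the class `a` occurs, and it has index `0` for the difference `1` as well.
  wlog hd : d ≠ 0 generalizing d
  · rw [not_not] at hd
    refine this (d := 1) (fun n hn => ?_) one_ne_zero
    obtain ⟨i, hi, h⟩ := hB n hn
    exact ⟨0, by omega, by simp [h, hd]⟩
  by_contra! hcon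
  rcases B.eq_empty_or_nonempty with rfl | hne
  · have := hcon 1 one_pos hp.one_lt
    simp [expSum] at this
  have hBpos : (0 : ℝ) < #B := by exact_mod_cast hne.card_pos
  choose! i hiL hi using hB
  -- The point opposite, on the circle of length `p`, to the midpoint of the indices `0, …, L - 1`;
  -- every index is at distance at least `ε * p / 2` from it.
  set i0 : ℝ := ((L : ℝ) + p - 1) / 2 with hi0
  set c : ℤ := ((d⁻¹).val : ℤ) with hc
  have hcd : (c : ZMod p) * d = 1 := by
    rw [hc, Int.cast_natCast, ZMod.natCast_zmod_val, inv_mul_cancel₀ hd]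
  have hc0 : (c : ZMod p) ≠ 0 := left_ne_zero_of_mul_eq_one hcd
  obtain ⟨a', ha'⟩ := ZMod.intCast_surjective a
  set M : ℝ := (#B : ℝ) / (2 * K) with hM
  -- the correlations with non-zero frequencies are small
  have hcorr : ∀ m : ℤ, m ≠ 0 → |m| < K →
      ‖∑ n ∈ B, expTwoPi (m * ((i0 - i n) / p))‖ ≤ M := by
    intro m hm0 hmK
    -- Frequency `m` in the index is frequency `-m * d⁻¹` in `n`; it is nonzero because `|m| < K <
    -- p`.
    set k : ℤ := (-(m * c)) % p with hk
    have hkmod : (k : ZMod p) = -(m * c) := by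
      rw [hk, ZMod.intCast_mod]
      push_cast
      ring
    have hk0 : 0 ≤ k := Int.emod_nonneg _ (by exact_mod_cast hp.ne_zero)
    have hkp : k < p := Int.emod_lt_of_pos _ (by exact_mod_cast hp.pos)
    have hkne : k ≠ 0 := by
      intro h0
      rw [h0, Int.cast_zero, eq_comm, neg_eq_zero, mul_eq_zero] at hkmod
      rcases hkmod with h | h
      · rw [ZMod.intCast_zmod_eq_zero_iff_dvd] at h
        exact hm0 (Int.eq_zero_of_abs_lt_dvd h (by omega))
      · exact hc0 h
    have hterm : ∀ n ∈ B, expTwoPi (m * ((i0 - i n) / p))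
        = expTwoPi (m * i0 / p - k * a' / p) * expTwoPi (n * (k.toNat / p)) := by
      intro n hn
      have e1 : expTwoPi (((-(m * i n) : ℤ) : ℝ) / p)
          = expTwoPi (((k * (n - a') : ℤ) : ℝ) / p) := by
        refine expTwoPi_div_eq_of_intCast_eq hp.pos ?_
        push_cast
        rw [hkmod, ha', hi n hn, nsmul_eq_mul]
        linear_combination (m * (i n : ZMod p)) * hcd
      have hkn : ((k.toNat : ℕ) : ℝ) = k := by
        rw [← Int.cast_natCast, Int.toNat_of_nonneg hk0]
      rw [hkn, show (m : ℝ) * ((i0 - i n) / p) = m * i0 / p + ((-(m * i n) : ℤ) : ℝ) / p by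
        push_cast; ring, expTwoPi_add, e1, ← expTwoPi_add, ← expTwoPi_add]
      congr 1
      push_cast
      ring
    rw [sum_congr rfl hterm, ← mul_sum, norm_mul, norm_expTwoPi, one_mul]
    exact (hcon k.toNat (by omega) (by omega)).le
  -- the Fejér kernel
  have hsmall : ∀ n ∈ B, ‖∑ j ∈ range K, expTwoPi (j * ((i0 - i n) / p))‖ ^ 2 ≤ K / 4 := by
    intro n hn
    have hin : (i n : ℝ) + 1 ≤ L := by exact_mod_cast hiL n hn
    have hin0 : (0 : ℝ) ≤ i n := Nat.cast_nonneg _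
    have h := norm_sum_range_expTwoPi_le (u := (i0 - i n) / p) hε
      (by rw [le_div_iff₀ hp0]; linarith) (by rw [div_le_iff₀ hp0]; linarith) K
    calc ‖∑ j ∈ range K, expTwoPi (j * ((i0 - i n) / p))‖ ^ 2 ≤ (1 / ε) ^ 2 := by gcongr
      _ = 4 / ε ^ 2 / 4 := by field_simp
      _ ≤ K / 4 := by gcongr
  have hexp : ((∑ n ∈ B, ‖∑ j ∈ range K, expTwoPi (j * ((i0 - i n) / p))‖ ^ 2 : ℝ) : ℂ)
      = ∑ j ∈ range K, ∑ l ∈ range K,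
        ∑ n ∈ B, expTwoPi (((j : ℤ) - (l : ℤ) : ℤ) * ((i0 - i n) / p)) := by
    rw [sum_congr rfl fun j _ => sum_comm, sum_comm]
    push_cast
    refine sum_congr rfl fun n _ => ?_
    rw [← Complex.mul_conj', map_sum, sum_mul_sum]
    refine sum_congr rfl fun j _ => sum_congr rfl fun l _ => ?_
    rw [conj_expTwoPi, ← expTwoPi_add]
    congr 1
    ring
  have hsplit : ∀ j ∈ range K, ∀ l ∈ range K,
      ‖(∑ n ∈ B, expTwoPi (((j : ℤ) - (l : ℤ) : ℤ) * ((i0 - i n) / p)))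
        - (if j = l then (#B : ℂ) else 0)‖ ≤ M := by
    intro j hj l hl
    rw [mem_range] at hj hl
    split_ifs with h
    · subst h
      simp only [sub_self, Int.cast_zero, zero_mul, expTwoPi_zero, sum_const, nsmul_eq_mul,
        mul_one, norm_zero]
      positivity
    · rw [sub_zero]
      exact hcorr _ (by omega) (by rw [abs_lt]; omega)
  have hdiag : ∑ j ∈ range K, ∑ l ∈ range K, (if j = l then (#B : ℂ) else 0) = K * #B := by
    rw [sum_congr rfl (g := fun _ => (#B : ℂ))]
    · simp
    · intro j hj
      rw [sum_ite_eq, if_pos hj]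
  -- The diagonal gives `K * #B` and the `K²` errors are at most `M` each, so the total is at least
  -- `K * #B / 2`; the pointwise kernel bound allows only `K * #B / 4`.
  have hfinal : ‖((∑ n ∈ B, ‖∑ j ∈ range K, expTwoPi (j * ((i0 - i n) / p))‖ ^ 2 : ℝ) : ℂ)
      - K * #B‖ ≤ K * (K * M) := by
    rw [hexp, ← hdiag, ← sum_sub_distrib]
    simp only [← sum_sub_distrib]
    refine (norm_sum_le _ _).trans ((sum_le_sum fun j hj => (norm_sum_le _ _).trans
      (sum_le_sum fun l hl => hsplit j hj l hl)).trans ?_)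
    simp
  have hcast : ((∑ n ∈ B, ‖∑ j ∈ range K, expTwoPi (j * ((i0 - i n) / p))‖ ^ 2 : ℝ) : ℂ)
      - K * #B = ((∑ n ∈ B, ‖∑ j ∈ range K, expTwoPi (j * ((i0 - i n) / p))‖ ^ 2
        - K * #B : ℝ) : ℂ) := by push_cast; ring
  rw [hcast, Complex.norm_real, Real.norm_eq_abs] at hfinal
  have hsum := sum_le_sum hsmall
  rw [sum_const, nsmul_eq_mul] at hsum
  have hKM : (K : ℝ) * (K * M) = K * #B / 2 := by rw [hM]; field_simp
  have h1 := (abs_le.1 hfinal).1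
  have : (0 : ℝ) < K * #B := by positivity
  linarith

/-! ### From Fourier bias to additive energy. -/

/-- A set with large exponential sums at fractions with many different prime denominators has
large additive energy. -/
theorem card_mul_le_energy {B : Finset ℤ} {X : ℝ} (hX : 1 ≤ X)
    (hB : ∀ n ∈ B, 1 ≤ n ∧ (n : ℝ) ≤ X) {c : ℝ} (hc : 0 < c) (hc1 : c ≤ 1) {Q : Finset ℕ}
    (hQ : ∀ p ∈ Q, p.Prime ∧ (p : ℝ) ^ 2 ≤ X)
    (hbias : ∀ p ∈ Q, ∃ k : ℕ, 0 < k ∧ k < p ∧ c * #B ≤ ‖expSum B (k / p)‖) :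
    #Q * (c ^ 5 * (#B : ℝ) ^ 4) ≤ 300 * X * ∑ h ∈ diffs B, (#(interShift B h) : ℝ) ^ 2 := by
  choose! k hk0 hkp hk using hbias
  -- This size of `N` prevents differences from wrapping around, exceeds every `p * q` so that
  -- distinct fractions `k/p` round to distinct grid points, and makes the rounding cost at most `c
  -- / 2 * #B`.
  set N : ℕ := ⌈16 * X / c⌉₊ with hN
  have hNge : 16 * X / c ≤ N := Nat.le_ceil _
  have hNX : 16 * X ≤ c * N := by
    rw [div_le_iff₀ hc] at hNge
    linarith
  have hNle : c * N ≤ 17 * X := by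
    have : (N : ℝ) < 16 * X / c + 1 := Nat.ceil_lt_add_one (by positivity)
    have h2 : c * N < c * (16 * X / c + 1) := by gcongr
    have h3 : c * (16 * X / c + 1) = 16 * X + c := by field_simp
    linarith
  have hNR : (0 : ℝ) < N := lt_of_lt_of_le (by positivity) hNge
  have hN0 : 0 < N := by exact_mod_cast hNR
  have hNX' : 16 * X ≤ N := by nlinarith
  set t : ℕ → ℕ := fun p => ⌊(N : ℝ) * (k p / p)⌋₊ with ht
  have hfloor : ∀ p ∈ Q, (t p : ℝ) ≤ N * (k p / p) ∧ (N : ℝ) * (k p / p) < t p + 1 := by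
    intro p _
    exact ⟨Nat.floor_le (by positivity), Nat.lt_floor_add_one _⟩
  have htN : ∀ p ∈ Q, t p < N := by
    intro p hp
    have hpp := (hQ p hp).1.pos
    have hlt : (k p : ℝ) / p < 1 := by
      rw [div_lt_one (by positivity)]; exact_mod_cast hkp p hp
    have : (t p : ℝ) < N := by nlinarith [(hfloor p hp).1]
    exact_mod_cast this
  have hinj : Set.InjOn t Q := by
    intro p hp q hq hpq
    by_contra hne
    have hpP := (hQ p hp).1
    have hqP := (hQ q hq).1
    have hp0 : (0 : ℝ) < p := by exact_mod_cast hpP.pos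
    have hq0 : (0 : ℝ) < q := by exact_mod_cast hqP.pos
    have hz : (k p : ℤ) * q - k q * p ≠ 0 := by
      intro h
      have h' : k p * q = k q * p := by exact_mod_cast sub_eq_zero.1 h
      have hd : p ∣ k p * q := h' ▸ dvd_mul_left _ _
      rcases hpP.dvd_mul.1 hd with h1 | h1
      · exact absurd (Nat.le_of_dvd (hk0 p hp) h1) (not_le.2 (hkp p hp))
      · exact hne ((Nat.prime_dvd_prime_iff_eq hpP hqP).1 h1)
    have h1 : (1 : ℝ) ≤ |(k p : ℝ) * q - k q * p| := by
      exact_mod_cast Int.one_le_abs hz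
    have h2 : |(N : ℝ) * (k p / p) - N * (k q / q)| < 1 := by
      have hp1 := hfloor p hp
      have hq1 := hfloor q hq
      rw [← hpq] at hq1
      rw [abs_lt]
      constructor <;> linarith
    have h3 : (N : ℝ) * (k p / p) - N * (k q / q) = N / (p * q) * ((k p : ℝ) * q - k q * p) := by
      field_simp
    rw [h3, abs_mul, abs_of_pos (by positivity)] at h2
    have h4 : (p : ℝ) * q ≤ X := by nlinarith [(hQ p hp).2, (hQ q hq).2, sq_nonneg ((p : ℝ) - q)]
    have h5 : (1 : ℝ) ≤ N / (p * q) := by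
      rw [le_div_iff₀ (by positivity)]
      linarith
    nlinarith
  have hlarge : ∀ p ∈ Q, c / 2 * #B ≤ ‖expSum B (t p / N)‖ := by
    intro p hp
    have hd : |(k p : ℝ) / p - t p / N| ≤ 1 / N := by
      have h1 := hfloor p hp
      rw [abs_le]
      constructor
      · have h2 : (t p : ℝ) / N ≤ k p / p := by
          rw [div_le_iff₀ hNR]
          linarith [h1.1]
        have h3 : (0 : ℝ) ≤ 1 / N := by positivity
        linarith
      · rw [sub_le_iff_le_add, ← add_div, le_div_iff₀ hNR]
        linarith [h1.2]
    have hdiff : ‖expSum B (k p / p) - expSum B (t p / N)‖ ≤ #B * (c / 2) := by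
      rw [expSum, expSum, ← sum_sub_distrib]
      refine (norm_sum_le _ _).trans ?_
      rw [← nsmul_eq_mul]
      refine sum_le_card_nsmul _ _ _ fun n hn => (norm_expTwoPi_sub_le _ _).trans ?_
      rw [← mul_sub, abs_mul]
      have hn1 : |(n : ℝ)| ≤ X := by
        rw [abs_of_nonneg (by exact_mod_cast (by linarith [(hB n hn).1] : (0 : ℤ) ≤ n))]
        exact (hB n hn).2
      calc 2 * Real.pi * (|(n : ℝ)| * |(k p : ℝ) / p - t p / N|)
          ≤ 2 * Real.pi * (X * (1 / N)) := by gcongr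
        _ ≤ 8 * (X * (1 / N)) := by gcongr; linarith [Real.pi_le_four]
        _ = 8 * X / N := by ring
        _ ≤ c / 2 := by rw [div_le_iff₀ hNR]; linarith
    have := hk p hp
    have h3 := norm_sub_norm_le (expSum B (k p / p)) (expSum B (t p / N))
    linarith
  have hE := sum_norm_expSum_pow_four (B := B) hN0 (by
    intro m hm n hn
    have h1 := hB m hm
    have h2 := hB n hn
    have hm1 : (1 : ℝ) ≤ m := by exact_mod_cast h1.1
    have hn1 : (1 : ℝ) ≤ n := by exact_mod_cast h2.1
    have h3 : |(m : ℝ) - n| ≤ X := by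
      rw [abs_le]; constructor <;> linarith [h1.2, h2.2]
    have h4 : 2 * |(m : ℝ) - n| < N := by linarith
    exact_mod_cast h4)
  have hlow : #Q * (c / 2 * #B) ^ 4 ≤ ∑ s ∈ range N, ‖expSum B (s / N)‖ ^ 4 := by
    calc #Q * (c / 2 * (#B : ℝ)) ^ 4 ≤ ∑ p ∈ Q, ‖expSum B (t p / N)‖ ^ 4 := by
          rw [← nsmul_eq_mul]
          refine card_nsmul_le_sum _ _ _ fun p hp => ?_
          have := hlarge p hp
          gcongr
      _ = ∑ s ∈ Q.image t, ‖expSum B (s / N)‖ ^ 4 :=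
          (sum_image (f := fun s : ℕ => ‖expSum B (s / N)‖ ^ 4) hinj).symm
      _ ≤ _ := by
          refine sum_le_sum_of_subset_of_nonneg ?_ fun _ _ _ => by positivity
          intro s hs
          obtain ⟨p, hp, rfl⟩ := mem_image.1 hs
          exact mem_range.2 (htN p hp)
  rw [hE] at hlow
  have hE0 : 0 ≤ ∑ h ∈ diffs B, (#(interShift B h) : ℝ) ^ 2 := sum_nonneg fun _ _ => by positivity
  generalize ∑ h ∈ diffs B, (#(interShift B h) : ℝ) ^ 2 = E at hlow hE0
  clear hE
  calc #Q * (c ^ 5 * (#B : ℝ) ^ 4) = 16 * c * (#Q * (c / 2 * #B) ^ 4) := by ring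
    _ ≤ 16 * c * (N * E) := by gcongr
    _ = 16 * (c * N) * E := by ring
    _ ≤ 16 * (17 * X) * E := by gcongr
    _ ≤ _ := by nlinarith [mul_nonneg (by linarith : (0 : ℝ) ≤ X) hE0]

/-! ### Confined sets, sieving primes and occupancy. -/

/-- The integers in `B` lie in `[1, X]` and, for every prime `p ≤ √X`, in an arithmetic progression
modulo `p` of length at most `(1 - ε) p`. -/
def Confined (ε X : ℝ) (B : Finset ℤ) : Prop :=
  (∀ n ∈ B, 1 ≤ n ∧ (n : ℝ) ≤ X) ∧
    ∀ p : ℕ, p.Prime → (p : ℝ) ≤ X ^ ((1 : ℝ) / 2) →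
      ∃ (a d : ZMod p) (L : ℕ), (L : ℝ) ≤ (1 - ε) * p ∧
        ∀ n ∈ B, ∃ i < L, (n : ZMod p) = a + i • d

theorem Confined.mono {ε X : ℝ} {B B' : Finset ℤ} (h : Confined ε X B) (hB : B' ⊆ B) :
    Confined ε X B' := by
  refine ⟨fun n hn => h.1 n (hB hn), fun p hp hpX => ?_⟩
  obtain ⟨a, d, L, hL, hn⟩ := h.2 p hp hpX
  exact ⟨a, d, L, hL, fun n hn' => hn n (hB hn')⟩

/-- The residue classes modulo `p` occupied by `B`. -/
def residues (B : Finset ℤ) (p : ℕ) : Finset (ZMod p) := B.image fun n : ℤ => (n : ZMod p)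

theorem Confined.card_residues_le {ε X : ℝ} {B : Finset ℤ} (h : Confined ε X B) {p : ℕ}
    (hp : p.Prime) (hpX : (p : ℝ) ≤ X ^ ((1 : ℝ) / 2)) : (#(residues B p) : ℝ) ≤ (1 - ε) * p := by
  obtain ⟨a, d, L, hL, hn⟩ := h.2 p hp hpX
  refine le_trans ?_ hL
  have : residues B p ⊆ (range L).image fun i : ℕ => a + i • d := by
    intro x hx
    obtain ⟨n, hnB, rfl⟩ := mem_image.1 hx
    obtain ⟨i, hi, e⟩ := hn n hnB
    exact mem_image.2 ⟨i, mem_range.2 hi, e.symm⟩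
  exact_mod_cast (card_le_card this).trans (card_image_le.trans_eq (card_range L))

theorem Confined.card_le {ε X : ℝ} (hX : 0 ≤ X) {B : Finset ℤ} (h : Confined ε X B) :
    (#B : ℝ) ≤ X := by
  have hsub : B ⊆ Icc 1 (⌊X⌋₊ : ℤ) := by
    intro n hn
    obtain ⟨h1, h2⟩ := h.1 n hn
    rw [mem_Icc]
    refine ⟨h1, ?_⟩
    have : n.toNat ≤ ⌊X⌋₊ := by
      refine Nat.le_floor ?_
      have : ((n.toNat : ℕ) : ℝ) = n := by
        rw [← Int.cast_natCast, Int.toNat_of_nonneg (by omega)]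
      rwa [this]
    omega
  have hc : #B ≤ ⌊X⌋₊ := by simpa using card_le_card hsub
  exact (Nat.cast_le.2 hc).trans (Nat.floor_le hX)

/-- The primes used for sieving. -/
noncomputable def sievePrimes (X : ℝ) : Finset ℕ :=
  (range (⌊X ^ ((9 : ℝ) / 20)⌋₊ + 1)).filter fun p => p.Prime ∧ 2000 < p

theorem mem_sievePrimes {X : ℝ} (hX : 0 ≤ X) {p : ℕ} :
    p ∈ sievePrimes X ↔ (p : ℝ) ≤ X ^ ((9 : ℝ) / 20) ∧ p.Prime ∧ 2000 < p := by
  rw [sievePrimes, mem_filter, mem_range, Nat.lt_succ_iff, Nat.le_floor_iff (by positivity)]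

/-- The logarithmic weight of a prime. -/
noncomputable def logWeight (p : ℕ) : ℝ := Real.log p / p

theorem logWeight_nonneg (p : ℕ) : 0 ≤ logWeight p :=
  div_nonneg (Real.log_natCast_nonneg p) (Nat.cast_nonneg p)

/-- The total logarithmic weight of the sieving primes. -/
noncomputable def totalWeight (X : ℝ) : ℝ := ∑ p ∈ sievePrimes X, logWeight p

/-- The weighted sum, over the sieving primes, of the proportion of occupied residue classes. -/
noncomputable def occupancy (X : ℝ) (B : Finset ℤ) : ℝ :=
  ∑ p ∈ sievePrimes X, logWeight p * (#(residues B p) / p)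

theorem totalWeight_nonneg (X : ℝ) : 0 ≤ totalWeight X :=
  sum_nonneg fun p _ => logWeight_nonneg p

theorem occupancy_le_totalWeight (X : ℝ) (B : Finset ℤ) : occupancy X B ≤ totalWeight X := by
  refine sum_le_sum fun p hp => mul_le_of_le_one_right (logWeight_nonneg p) ?_
  have hpp : p.Prime := (mem_filter.1 hp).2.1
  have := Fact.mk hpp
  have hp0 : (0 : ℝ) < p := by exact_mod_cast hpp.pos
  rw [div_le_one hp0]
  exact_mod_cast (card_le_univ (residues B p)).trans_eq (ZMod.card p)

/-- Mertens gives `9 / 20 * log X` up to a constant; the primes up to `2000` and the rounding also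
cost a constant, all absorbed by `0.01 * log X`. -/
theorem exists_totalWeight_ge :
    ∃ X₀ : ℝ, ∀ X, X₀ ≤ X → 0.44 * Real.log X ≤ totalWeight X := by
  obtain ⟨C, hC⟩ := exists_log_sub_le_sum_log_div
  obtain ⟨S, hS⟩ : ∃ S : Finset ℕ, ∀ p : ℕ, p ≤ 2000 → p ∈ S :=
    ⟨range (2000 + 1), fun p hp => mem_range.2 (Nat.lt_succ_of_le hp)⟩
  set D : ℝ := ∑ p ∈ S, logWeight p with hD
  have htend : Filter.Tendsto (fun X : ℝ => 0.01 * Real.log X) Filter.atTop Filter.atTop :=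
    Real.tendsto_log_atTop.const_mul_atTop (by norm_num)
  have hev := htend.eventually_ge_atTop (C + D + Real.log 2)
  obtain ⟨X₁, hX₁⟩ := Filter.eventually_atTop.1 hev
  refine ⟨max X₁ 1, fun X hX => ?_⟩
  have hX1 : 1 ≤ X := (le_max_right _ _).trans hX
  have h1 := hX₁ X ((le_max_left _ _).trans hX)
  set y := X ^ ((9 : ℝ) / 20) with hy
  have hy1 : 1 ≤ y := Real.one_le_rpow hX1 (by norm_num)
  have hn : 1 ≤ ⌊y⌋₊ := Nat.le_floor (by simpa using hy1)
  have h2 := hC ⌊y⌋₊ hn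
  have h3 : Real.log y - Real.log 2 ≤ Real.log ⌊y⌋₊ := by
    rw [← Real.log_div (by positivity) (by norm_num)]
    refine Real.log_le_log (by positivity) ?_
    have : y < ⌊y⌋₊ + 1 := Nat.lt_floor_add_one y
    have : (1 : ℝ) ≤ ⌊y⌋₊ := by exact_mod_cast hn
    linarith
  have h4 : Real.log y = 9 / 20 * Real.log X := Real.log_rpow (by linarith) _
  have h5 : ∑ p ∈ (range (⌊y⌋₊ + 1)).filter Nat.Prime, Real.log p / p ≤ totalWeight X + D := by
    rw [totalWeight, hD]
    refine (sum_le_sum_of_subset_of_nonneg (t := sievePrimes X ∪ S) ?_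
      fun p _ _ => logWeight_nonneg p).trans ?_
    · intro p hp
      rw [mem_filter] at hp
      rw [mem_range] at hp
      rw [mem_union, sievePrimes, mem_filter, mem_range]
      rcases lt_or_ge 2000 p with h | h
      · exact Or.inl ⟨hp.1, hp.2, h⟩
      · exact Or.inr (hS p h)
    · have := sum_union_inter (s₁ := sievePrimes X) (s₂ := S)
        (f := logWeight)
      have h0 : 0 ≤ ∑ p ∈ sievePrimes X ∩ S, logWeight p :=
        sum_nonneg fun p _ => logWeight_nonneg p
      change ∑ p ∈ sievePrimes X ∪ S, logWeight p ≤ _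
      linarith
  linarith

theorem sum_log_sievePrimes_le {X : ℝ} (hX : 1 ≤ X) :
    ∑ p ∈ sievePrimes X, Real.log p ≤ X ^ ((9 : ℝ) / 20) * Real.log X := by
  have hX0 : 0 ≤ X := by linarith
  have h1 : ∀ p ∈ sievePrimes X, Real.log p ≤ Real.log X := by
    intro p hp
    obtain ⟨hpX, hpp, -⟩ := (mem_sievePrimes hX0).1 hp
    refine Real.log_le_log (by exact_mod_cast hpp.pos) (hpX.trans ?_)
    calc X ^ ((9 : ℝ) / 20) ≤ X ^ (1 : ℝ) := Real.rpow_le_rpow_of_exponent_le hX (by norm_num)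
      _ = X := Real.rpow_one X
  have h2 : (#(sievePrimes X) : ℝ) ≤ X ^ ((9 : ℝ) / 20) := by
    have hsub : sievePrimes X ⊆ Icc 1 ⌊X ^ ((9 : ℝ) / 20)⌋₊ := by
      intro p hp
      rw [sievePrimes, mem_filter, mem_range] at hp
      rw [mem_Icc]
      omega
    have hc : #(sievePrimes X) ≤ ⌊X ^ ((9 : ℝ) / 20)⌋₊ := by simpa using card_le_card hsub
    exact (Nat.cast_le.2 hc).trans (Nat.floor_le (by positivity))
  calc ∑ p ∈ sievePrimes X, Real.log p ≤ #(sievePrimes X) • Real.log X := sum_le_card_nsmul _ _ _ h1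
    _ = #(sievePrimes X) * Real.log X := nsmul_eq_mul _ _
    _ ≤ _ := mul_le_mul_of_nonneg_right h2 (Real.log_nonneg hX)

theorem Confined.abs_sub_le {ε X : ℝ} {B : Finset ℤ} (h : Confined ε X B) {m n : ℤ} (hm : m ∈ B)
    (hn : n ∈ B) : |((m - n : ℤ) : ℝ)| ≤ X := by
  have h1 := h.1 m hm
  have h2 := h.1 n hn
  have hm1 : (1 : ℝ) ≤ m := by exact_mod_cast h1.1
  have hn1 : (1 : ℝ) ≤ n := by exact_mod_cast h2.1
  rw [Int.cast_sub, abs_le]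
  constructor <;> linarith [h1.2, h2.2]

/-- Here `4 - 4 * s` is the tangent to `1 / s` at `s = 1 / 2`. It turns the larger sieve's weight `p
/ #(residues B p)` into a bound linear in the occupancy. -/
theorem sq_mul_four_sub_le {b r c q : ℝ} (hq : 0 < q) (hr : 0 ≤ r) (hc : 0 ≤ c)
    (h : b ^ 2 ≤ r * c) : b ^ 2 * (4 - 4 * (r / q)) ≤ q * c := by
  obtain ⟨s, rfl⟩ : ∃ s, r = s * q := ⟨r / q, (div_mul_cancel₀ r hq.ne').symm⟩
  rw [mul_div_cancel_right₀ _ hq.ne']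
  rcases le_total (4 - 4 * s) 0 with h0 | h0
  · exact (mul_nonpos_of_nonneg_of_nonpos (sq_nonneg _) h0).trans (by positivity)
  · calc b ^ 2 * (4 - 4 * s) ≤ s * q * c * (4 - 4 * s) := mul_le_mul_of_nonneg_right h h0
      _ = (1 - (1 - 2 * s) ^ 2) * (q * c) := by ring
      _ ≤ 1 * (q * c) :=
        mul_le_mul_of_nonneg_right (by linarith [sq_nonneg (1 - 2 * s)]) (by positivity)
      _ = q * c := one_mul _

/-- A set that occupies few residue classes on average is small, by the larger sieve. -/
theorem card_le_of_occupancy_le {ε X : ℝ} (hX : 1 < X)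
    (hW : 0.44 * Real.log X ≤ totalWeight X) {B : Finset ℤ} (hB : Confined ε X B)
    (hocc : occupancy X B ≤ 3 / 8 * totalWeight X) : (#B : ℝ) ≤ 10 * X ^ ((9 : ℝ) / 20) := by
  have hlog : 0 < Real.log X := Real.log_pos hX
  have hP : ∀ p ∈ sievePrimes X, p.Prime := fun p hp => (mem_filter.1 hp).2.1
  have hs := larger_sieve hX.le (fun m hm n hn => hB.abs_sub_le hm hn) hP
  have hterm : ∀ p ∈ sievePrimes X,
      (#B : ℝ) ^ 2 * (4 * logWeight p - 4 * (logWeight p * (#(residues B p) / p)))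
        ≤ Real.log p * #((B ×ˢ B).filter fun x => (x.1 : ZMod p) = (x.2 : ZMod p)) := by
    intro p hp
    have hp0 : (0 : ℝ) < p := by exact_mod_cast (hP p hp).pos
    have hcs := card_sq_le_card_image_mul_collisions B fun n : ℤ => (n : ZMod p)
    have key := sq_mul_four_sub_le hp0 (Nat.cast_nonneg _) (Nat.cast_nonneg _) hcs
    calc (#B : ℝ) ^ 2 * (4 * logWeight p - 4 * (logWeight p * (#(residues B p) / p)))
        = logWeight p * ((#B : ℝ) ^ 2 * (4 - 4 * (#(residues B p) / p))) := by ring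
      _ ≤ logWeight p *
          (p * #((B ×ˢ B).filter fun x => (x.1 : ZMod p) = (x.2 : ZMod p))) :=
        mul_le_mul_of_nonneg_left key (logWeight_nonneg p)
      _ = _ := by rw [logWeight, ← mul_assoc, div_mul_cancel₀ _ hp0.ne']
  have hsum := (sum_le_sum hterm).trans hs
  rw [← mul_sum, sum_sub_distrib, ← mul_sum, ← mul_sum] at hsum
  change (#B : ℝ) ^ 2 * (4 * totalWeight X - 4 * occupancy X B) ≤ _ at hsum
  -- `4 * (1 - 3 / 8) * 0.44 = 1.1`, which beats the coefficient `1` of `log X` in the larger sieve.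
  have hlow : 1.1 * Real.log X ≤ 4 * totalWeight X - 4 * occupancy X B := by linarith
  have h1 : (#B : ℝ) ^ 2 * (1.1 * Real.log X)
      ≤ #B * (X ^ ((9 : ℝ) / 20) * Real.log X) + (#B : ℝ) ^ 2 * Real.log X :=
    (mul_le_mul_of_nonneg_left hlow (sq_nonneg _)).trans (hsum.trans
      (add_le_add_left (mul_le_mul_of_nonneg_left (sum_log_sievePrimes_le hX.le)
        (Nat.cast_nonneg _)) _))
  rcases (Nat.cast_nonneg (α := ℝ) #B).eq_or_lt with h0 | h0
  · rw [← h0]; positivity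
  · have h2 : (#B : ℝ) * Real.log X * #B ≤ #B * Real.log X * (10 * X ^ ((9 : ℝ) / 20)) := by
      nlinarith
    exact le_of_mul_le_mul_left h2 (by positivity)

/-- The sieving primes modulo which `B` occupies at least a quarter of the residue classes and
which `h` nearly preserves. -/
noncomputable def stablePrimes (ε X : ℝ) (B : Finset ℤ) (h : ℤ) : Finset ℕ :=
  (sievePrimes X).filter fun p => (p : ℝ) / 4 ≤ #(residues B p) ∧
    (shiftDefect (residues B p) (h : ZMod p) : ℝ) < ε / 8000 * p

theorem rpow_nine_twentieths_le {X : ℝ} (hX : 1 ≤ X) :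
    X ^ ((9 : ℝ) / 20) ≤ X ^ ((1 : ℝ) / 2) :=
  Real.rpow_le_rpow_of_exponent_le hX (by norm_num)

/-- Few translations nearly preserve `B` modulo many primes. -/
theorem card_le_of_stablePrimes {ε X : ℝ} (hε : 0 < ε) (hX : 4 ≤ X)
    (hW : 0.44 * Real.log X ≤ totalWeight X) {B : Finset ℤ} (hB : Confined ε X B) {H : Finset ℤ}
    (hH : ∀ h ∈ H, |(h : ℝ)| ≤ X)
    (hst : ∀ h ∈ H, totalWeight X / 16 ≤ ∑ p ∈ stablePrimes ε X B h, logWeight p) :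
    (#H : ℝ) ≤ 10 * X ^ ((9 : ℝ) / 20) := by
  classical
  have hX1 : 1 ≤ X := by linarith
  have hlog : 0 < Real.log X := Real.log_pos (by linarith)
  have hP : ∀ p ∈ sievePrimes X, p.Prime := fun p hp => (mem_filter.1 hp).2.1
  have hs := larger_sieve (B := H) (Y := 2 * X) (by linarith) (fun m hm n hn => by
    rw [Int.cast_sub]
    refine (abs_sub _ _).trans ?_
    linarith [hH m hm, hH n hn]) hP
  set F : ℕ → Finset ℤ := fun p => H.filter fun h => p ∈ stablePrimes ε X B h with hF
  have hterm : ∀ p ∈ sievePrimes X, 1000 * (logWeight p * (#(F p) : ℝ) ^ 2)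
      ≤ Real.log p * #((H ×ˢ H).filter fun x => (x.1 : ZMod p) = (x.2 : ZMod p)) := by
    intro p hp
    obtain ⟨hpX, hpp, hp2⟩ := (mem_sievePrimes (by linarith)).1 hp
    have hp0 : (0 : ℝ) < p := by exact_mod_cast hpp.pos
    have hcs := card_sq_le_card_image_mul_collisions (F p) fun n : ℤ => (n : ZMod p)
    have hmono : (#((F p ×ˢ F p).filter fun x => (x.1 : ZMod p) = (x.2 : ZMod p)) : ℝ)
        ≤ #((H ×ˢ H).filter fun x => (x.1 : ZMod p) = (x.2 : ZMod p)) := by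
      exact_mod_cast card_le_card (filter_subset_filter _
        (product_subset_product (filter_subset _ _) (filter_subset _ _)))
    have himg : (#((F p).image fun n : ℤ => (n : ZMod p)) : ℝ) ≤ p / 1000 := by
      rcases (F p).eq_empty_or_nonempty with he | ⟨h0, hh0⟩
      · rw [he, image_empty, card_empty, Nat.cast_zero]
        positivity
      · have hact := (mem_filter.1 (mem_filter.1 hh0).2).2.1
        refine card_small_shiftDefect_le hpp hp2 hε hact
          (hB.card_residues_le hpp (hpX.trans (rpow_nine_twentieths_le hX1))) ?_
        intro x hx
        obtain ⟨h, hh, rfl⟩ := mem_image.1 hx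
        exact (mem_filter.1 (mem_filter.1 hh).2).2.2
    set c : ℝ := ((#((H ×ˢ H).filter fun x => (x.1 : ZMod p) = (x.2 : ZMod p)) : ℕ) : ℝ)
    have hcs' : (#(F p) : ℝ) ^ 2 ≤ p / 1000 * c :=
      hcs.trans (mul_le_mul himg hmono (Nat.cast_nonneg _) (by positivity))
    calc 1000 * (logWeight p * (#(F p) : ℝ) ^ 2) ≤ 1000 * (logWeight p * (p / 1000 * c)) :=
          mul_le_mul_of_nonneg_left (mul_le_mul_of_nonneg_left hcs' (logWeight_nonneg p))
            (by norm_num)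
      _ = Real.log p * c := by rw [logWeight]; field_simp
  have hcount : #H * (totalWeight X / 16) ≤ ∑ p ∈ sievePrimes X, logWeight p * #(F p) := by
    calc #H * (totalWeight X / 16) ≤ ∑ h ∈ H, ∑ p ∈ stablePrimes ε X B h, logWeight p := by
          rw [← nsmul_eq_mul]
          exact card_nsmul_le_sum _ _ _ hst
      _ = ∑ h ∈ H, ∑ p ∈ sievePrimes X,
            if p ∈ stablePrimes ε X B h then logWeight p else 0 := by
          refine sum_congr rfl fun h _ => ?_
          rw [← sum_filter]
          congr 1
          ext p
          rw [mem_filter]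
          exact ⟨fun hp => ⟨(mem_filter.1 hp).1, hp⟩, fun hp => hp.2⟩
      _ = ∑ p ∈ sievePrimes X, logWeight p * #(F p) := by
          rw [sum_comm]
          refine sum_congr rfl fun p _ => ?_
          rw [← sum_filter, sum_const, nsmul_eq_mul, mul_comm]
  -- Cauchy–Schwarz in tangent form at `#H / 16`, the lower bound for the weighted mean of `#(F p)`.
  have hsq : totalWeight X * (#H : ℝ) ^ 2 / 256
      ≤ ∑ p ∈ sievePrimes X, logWeight p * (#(F p) : ℝ) ^ 2 := by
    have hpt : ∀ p ∈ sievePrimes X, (#H : ℝ) / 8 * (logWeight p * #(F p))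
        - logWeight p * ((#H : ℝ) / 16) ^ 2 ≤ logWeight p * (#(F p) : ℝ) ^ 2 := by
      intro p _
      nlinarith [mul_nonneg (logWeight_nonneg p) (sq_nonneg ((#(F p) : ℝ) - #H / 16))]
    have := sum_le_sum hpt
    rw [sum_sub_distrib, ← mul_sum, ← sum_mul] at this
    change _ - totalWeight X * _ ≤ _ at this
    have h0 : (0 : ℝ) ≤ #H := Nat.cast_nonneg _
    nlinarith
  have hsum := (sum_le_sum hterm).trans hs
  rw [← mul_sum] at hsum
  have hlog2 : Real.log (2 * X) ≤ 1.5 * Real.log X := by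
    rw [Real.log_mul (by norm_num) (by linarith)]
    have : Real.log 4 ≤ Real.log X := Real.log_le_log (by norm_num) hX
    have h4 : Real.log 4 = 2 * Real.log 2 := by
      rw [show (4 : ℝ) = 2 ^ 2 by norm_num, Real.log_pow]; norm_num
    linarith
  have hsl := sum_log_sievePrimes_le hX1
  rcases (Nat.cast_nonneg (α := ℝ) #H).eq_or_lt with h0 | h0
  · rw [← h0]; positivity
  · have h1 : (#H : ℝ) * ∑ p ∈ sievePrimes X, Real.log p
        ≤ #H * (X ^ ((9 : ℝ) / 20) * Real.log X) := mul_le_mul_of_nonneg_left hsl h0.le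
    have h2 : (#H : ℝ) ^ 2 * Real.log (2 * X) ≤ (#H : ℝ) ^ 2 * (1.5 * Real.log X) :=
      mul_le_mul_of_nonneg_left hlog2 (sq_nonneg _)
    have h3 : (#H : ℝ) ^ 2 * (0.44 * Real.log X) ≤ (#H : ℝ) ^ 2 * totalWeight X :=
      mul_le_mul_of_nonneg_left hW (sq_nonneg _)
    have h5 : 0 ≤ (#H : ℝ) ^ 2 * Real.log X := by positivity
    -- As `1000 / 256 * 0.44 > 1.7`, the main term exceeds the `1.5 * log X` coming from `log (2 *
    -- X)`.
    have h4 : (#H : ℝ) * Real.log X * #H ≤ #H * Real.log X * (10 * X ^ ((9 : ℝ) / 20)) := by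
      linarith
    exact le_of_mul_le_mul_left h4 (by positivity)

/-- A class met by `B ∩ (B + h)` lies both in the residues of `B` and in their translate by `h`, so
the classes counted by the defect are lost. -/
theorem card_residues_interShift_add_le (B : Finset ℤ) (h : ℤ) (p : ℕ) :
    #(residues (interShift B h) p) + shiftDefect (residues B p) (h : ZMod p)
      ≤ #(residues B p) := by
  rw [← card_filter_sub_mem (residues B p) (h : ZMod p)]
  refine Nat.add_le_add_right (card_le_card fun x hx => ?_) _
  obtain ⟨n, hn, rfl⟩ := mem_image.1 hx
  rw [interShift, mem_filter] at hn
  rw [mem_filter]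
  refine ⟨mem_image_of_mem _ hn.1, ?_⟩
  have := mem_image_of_mem (fun n : ℤ => (n : ZMod p)) hn.2
  rwa [Int.cast_sub] at this

/-- A translation which does not nearly preserve `B` reduces its occupancy. -/
theorem occupancy_interShift_le {ε X : ℝ} (hε : 0 < ε) {B : Finset ℤ} {h : ℤ}
    (hocc : 3 / 8 * totalWeight X ≤ occupancy X B)
    (hst : ∑ p ∈ stablePrimes ε X B h, logWeight p ≤ totalWeight X / 16) :
    occupancy X (interShift B h) ≤ occupancy X B - ε / 8000 / 16 * totalWeight X := by
  classical
  set U := (sievePrimes X).filter fun p : ℕ => (p : ℝ) / 4 ≤ #(residues B p) with hU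
  have hP : ∀ p ∈ sievePrimes X, (0 : ℝ) < p := fun p hp => by
    exact_mod_cast (mem_filter.1 hp).2.1.pos
  -- Sparse primes contribute at most a quarter of the total weight to the occupancy, leaving `3 / 8
  -- - 1 / 4 = 1 / 8` for `U`; removing stable primes leaves `1 / 16`.
  have hUw : totalWeight X / 8 ≤ ∑ p ∈ U, logWeight p := by
    have h1 : occupancy X B ≤ ∑ p ∈ sievePrimes X,
        ((if (p : ℝ) / 4 ≤ #(residues B p) then logWeight p else 0) + logWeight p * (1 / 4)) := by
      refine sum_le_sum fun p hp => ?_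
      have hp0 := hP p hp
      have hpp : p.Prime := (mem_filter.1 hp).2.1
      have := Fact.mk hpp
      have hw := logWeight_nonneg p
      split_ifs with hc
      · have : (#(residues B p) : ℝ) / p ≤ 1 := by
          rw [div_le_one hp0]
          exact_mod_cast (card_le_univ (residues B p)).trans_eq (ZMod.card p)
        nlinarith
      · rw [zero_add]
        refine mul_le_mul_of_nonneg_left ?_ hw
        rw [div_le_iff₀ hp0]
        linarith
    rw [sum_add_distrib, ← sum_filter, ← sum_mul] at h1
    change _ ≤ ∑ p ∈ U, logWeight p + totalWeight X * (1 / 4) at h1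
    linarith
  have hsub : stablePrimes ε X B h ⊆ U := fun p hp => by
    rw [stablePrimes, mem_filter] at hp
    exact mem_filter.2 ⟨hp.1, hp.2.1⟩
  have hsd := sum_sdiff (f := logWeight) hsub
  have hpt : ∀ p ∈ sievePrimes X, logWeight p * (#(residues (interShift B h) p) / p)
      ≤ logWeight p * (#(residues B p) / p)
        - (if p ∈ U \ stablePrimes ε X B h then ε / 8000 * logWeight p else 0) := by
    intro p hp
    have hp0 := hP p hp
    have hw := logWeight_nonneg p
    have hc : (#(residues (interShift B h) p) : ℝ) + shiftDefect (residues B p) (h : ZMod p)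
        ≤ #(residues B p) := by
      exact_mod_cast card_residues_interShift_add_le B h p
    have hd0 : (0 : ℝ) ≤ shiftDefect (residues B p) (h : ZMod p) := Nat.cast_nonneg _
    split_ifs with hm
    · rw [mem_sdiff, hU, mem_filter, stablePrimes, mem_filter] at hm
      have hdef : ε / 8000 * p ≤ shiftDefect (residues B p) (h : ZMod p) := by
        by_contra! hlt
        exact hm.2 ⟨hm.1.1, hm.1.2, hlt⟩
      have : (#(residues (interShift B h) p) : ℝ) / p ≤ #(residues B p) / p - ε / 8000 := by
        rw [div_le_iff₀ hp0, sub_mul, div_mul_cancel₀ _ hp0.ne']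
        linarith
      nlinarith
    · rw [sub_zero]
      exact mul_le_mul_of_nonneg_left
        (div_le_div_of_nonneg_right (by linarith) hp0.le) hw
  have hsum := sum_le_sum hpt
  rw [sum_sub_distrib, ← sum_filter, ← mul_sum] at hsum
  change occupancy X (interShift B h) ≤ occupancy X B - _ at hsum
  have hfe : (sievePrimes X).filter (fun p => p ∈ U \ stablePrimes ε X B h)
      = U \ stablePrimes ε X B h := by
    ext p
    rw [mem_filter]
    exact ⟨fun hp => hp.2, fun hp => ⟨(mem_filter.1 (mem_sdiff.1 hp).1).1, hp⟩⟩
  rw [hfe] at hsum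
  have : ε / 8000 * (totalWeight X / 16) ≤ ε / 8000 * ∑ p ∈ U \ stablePrimes ε X B h, logWeight p :=
    mul_le_mul_of_nonneg_left (by linarith) (by positivity)
  linarith

/-! ### Energy bounds and the induction on occupancy. -/

/-- Confined sets have large additive energy. -/
theorem exists_energy_ge {ε : ℝ} (hε : 0 < ε) :
    ∃ c : ℝ, 0 < c ∧ ∃ X₀ : ℝ, ∀ X, X₀ ≤ X → ∀ B : Finset ℤ, Confined ε X B →
      c * (#B : ℝ) ^ 4
        ≤ X ^ ((1 : ℝ) / 2) * Real.log X * ∑ h ∈ diffs B, (#(interShift B h) : ℝ) ^ 2 := by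
  set K : ℕ := ⌈4 / ε ^ 2⌉₊ with hKdef
  have hK : 4 / ε ^ 2 ≤ K := Nat.le_ceil _
  have hK0 : (0 : ℝ) < K := lt_of_lt_of_le (by positivity) hK
  have hK1 : (1 : ℝ) ≤ K := by
    have : 0 < K := by exact_mod_cast hK0
    exact_mod_cast this
  set c : ℝ := 1 / (2 * K) with hc
  have hc0 : 0 < c := by positivity
  have hc1 : c ≤ 1 := by
    rw [hc, div_le_one (by positivity)]
    linarith
  have hlo : ∀ᶠ y : ℝ in Filter.atTop, Real.log y ≤ 1 / (100 * (K + 2)) * y := by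
    have := Real.isLittleO_log_id_atTop.bound
      (by positivity : (0 : ℝ) < 1 / (100 * ((K : ℝ) + 2)))
    filter_upwards [this, Filter.eventually_ge_atTop 1] with y hy hy1
    rw [Real.norm_of_nonneg (Real.log_nonneg hy1), id, Real.norm_of_nonneg (by linarith)] at hy
    exact hy
  obtain ⟨y₀, hy₀⟩ := Filter.eventually_atTop.1 hlo
  refine ⟨c ^ 5 / 300, by positivity, max (max y₀ 20 ^ 2) 1, fun X hX B hB => ?_⟩
  have hX1 : 1 ≤ X := (le_max_right _ _).trans hX
  set y := X ^ ((1 : ℝ) / 2) with hy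
  have hyX : y ^ 2 = X := by
    rw [hy, ← Real.rpow_natCast, ← Real.rpow_mul (by linarith)]
    norm_num
  have hy0 : 0 ≤ y := by positivity
  have hym : max y₀ 20 ≤ y := by
    have h1 : max y₀ 20 ^ 2 ≤ y ^ 2 := hyX ▸ (le_max_left _ _).trans hX
    exact le_of_sq_le_sq h1 hy0
  have hy20 : 20 ≤ y := (le_max_right _ _).trans hym
  have hlogy := hy₀ y ((le_max_left _ _).trans hym)
  have hlogX : Real.log X = 2 * Real.log y := by rw [← hyX, Real.log_pow]; norm_num
  have hlogy0 : 0 < Real.log y := Real.log_pos (by linarith)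
  set Q := (range (⌊y⌋₊ + 1)).filter fun p => p.Prime ∧ K < p with hQ
  have hQcard : (Nat.primeCounting ⌊y⌋₊ : ℝ) ≤ #Q + (K + 1) := by
    have : Nat.primeCounting ⌊y⌋₊ ≤ #Q + (K + 1) := by
      rw [Nat.primeCounting, Nat.primeCounting', Nat.count_eq_card_filter_range]
      calc #((range (⌊y⌋₊ + 1)).filter Nat.Prime) ≤ #(Q ∪ range (K + 1)) := by
            refine card_le_card fun p hp => ?_
            rw [mem_filter] at hp
            rw [mem_union, hQ, mem_filter, mem_range (n := K + 1)]
            rcases lt_or_ge K p with h | h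
            · exact Or.inl ⟨hp.1, hp.2, h⟩
            · exact Or.inr (by omega)
        _ ≤ _ := (card_union_le _ _).trans (by rw [card_range])
    exact_mod_cast this
  -- Chebyshev gives about `y * log 2` for `π(y) * log y`, and `log X = 2 * log y`; since `2 * log 2
  -- > 1`, there is room for the primes up to `K` and lower-order terms.
  have hQlog : y ≤ #Q * Real.log X := by
    have h1 := Chebyshev.pi_ge' (x := y) (by linarith)
    rw [div_le_iff₀ hlogy0] at h1
    have h2 : Real.log (y + 2) ≤ 2 * Real.log y := by
      rw [show 2 * Real.log y = Real.log (y ^ 2) by rw [Real.log_pow]; norm_num]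
      exact Real.log_le_log (by linarith) (by nlinarith)
    have h3 := Real.log_two_gt_d9
    have h4 : (K + 2) * Real.log y ≤ y / 100 := by
      calc (K + 2) * Real.log y ≤ (K + 2) * (1 / (100 * (K + 2)) * y) := by gcongr
        _ = y / 100 := by field_simp
    have h5 : (Nat.primeCounting ⌊y⌋₊ : ℝ) * Real.log y ≤ (#Q + (K + 1)) * Real.log y := by
      gcongr
    have h6 : (y - 1) * 0.69 ≤ (y - 1) * Real.log 2 := by
      apply mul_le_mul_of_nonneg_left _ (by linarith)
      linarith
    have h7 : Real.log y ≤ y / 200 := by nlinarith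
    rw [hlogX]
    nlinarith
  have hE := card_mul_le_energy hX1 hB.1 hc0 hc1 (Q := Q) (by
    intro p hp
    rw [hQ, mem_filter, mem_range, Nat.lt_succ_iff, Nat.le_floor_iff hy0] at hp
    refine ⟨hp.2.1, ?_⟩
    rw [← hyX]
    exact pow_le_pow_left₀ (Nat.cast_nonneg p) hp.1 2) (by
    intro p hp
    rw [hQ, mem_filter, mem_range, Nat.lt_succ_iff, Nat.le_floor_iff hy0] at hp
    obtain ⟨a, d, L, hL, hn⟩ := hB.2 p hp.2.1 hp.1
    obtain ⟨k, hk0, hkp, hk⟩ := exists_large_expSum hp.2.1 hε hK hp.2.2 hL hn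
    refine ⟨k, hk0, hkp, le_of_eq_of_le ?_ hk⟩
    rw [hc]
    ring)
  set E := ∑ h ∈ diffs B, (#(interShift B h) : ℝ) ^ 2
  have h1 : y * (c ^ 5 * (#B : ℝ) ^ 4) ≤ #Q * Real.log X * (c ^ 5 * (#B : ℝ) ^ 4) := by gcongr
  have h2 : Real.log X * (#Q * (c ^ 5 * (#B : ℝ) ^ 4)) ≤ Real.log X * (300 * X * E) :=
    mul_le_mul_of_nonneg_left hE (Real.log_nonneg hX1)
  have h3 : y * (c ^ 5 / 300 * (#B : ℝ) ^ 4) ≤ y * (y * Real.log X * E) := by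
    have : y * (y * Real.log X * E) = X * Real.log X * E := by rw [← hyX]; ring
    rw [this]
    linarith
  exact le_of_mul_le_mul_left h3 (by linarith)

/-- The energy is small if most translates of `B` meet `B` in few points. -/
theorem energy_le {B H : Finset ℤ} {R : ℝ} (hHB : H ⊆ diffs B)
    (hR : ∀ h ∈ diffs B, h ∉ H → (#(interShift B h) : ℝ) ≤ R) (hR0 : 0 ≤ R) :
    ∑ h ∈ diffs B, (#(interShift B h) : ℝ) ^ 2 ≤ (#H + R) * (#B : ℝ) ^ 2 := by
  have hle : ∀ h, (#(interShift B h) : ℝ) ≤ #B := fun h => by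
    exact_mod_cast card_le_card (filter_subset _ _)
  have hs : ∑ h ∈ diffs B, (#(interShift B h) : ℝ) = (#B : ℝ) ^ 2 := by
    exact_mod_cast sum_card_interShift B
  rw [← sum_sdiff hHB, add_mul, add_comm]
  refine add_le_add ?_ ?_
  · rw [← nsmul_eq_mul]
    refine sum_le_card_nsmul _ _ _ fun h _ => ?_
    have := hle h
    gcongr
  · calc ∑ h ∈ diffs B \ H, (#(interShift B h) : ℝ) ^ 2
        ≤ ∑ h ∈ diffs B \ H, R * (#(interShift B h) : ℝ) := by
          refine sum_le_sum fun h hh => ?_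
          rw [mem_sdiff] at hh
          rw [sq]
          exact mul_le_mul_of_nonneg_right (hR h hh.1 hh.2) (Nat.cast_nonneg _)
      _ ≤ ∑ h ∈ diffs B, R * (#(interShift B h) : ℝ) :=
          sum_le_sum_of_subset_of_nonneg sdiff_subset fun _ _ _ => by positivity
      _ = R * (#B : ℝ) ^ 2 := by rw [← mul_sum, hs]

/-- The bound for confined sets, by induction on the occupancy. -/
theorem exists_card_le_of_occupancy {ε : ℝ} (hε : 0 < ε) :
    ∃ X₀ : ℝ, ∀ j : ℕ, ∃ δ C : ℝ, 0 < δ ∧ δ ≤ 1 / 20 ∧ 0 < C ∧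
      ∀ X, X₀ ≤ X → ∀ B : Finset ℤ, Confined ε X B →
        occupancy X B ≤ (3 / 8 + j * (ε / 8000 / 16)) * totalWeight X →
        (#B : ℝ) ≤ C * X ^ ((1 : ℝ) / 2 - δ) := by
  classical
  obtain ⟨X₁, hX₁⟩ := exists_totalWeight_ge
  obtain ⟨c, hc, X₂, hX₂⟩ := exists_energy_ge hε
  refine ⟨max (max X₁ X₂) 4, fun j => ?_⟩
  induction j with
  | zero =>
    refine ⟨1 / 20, 10, by norm_num, le_rfl, by norm_num, fun X hX B hB hocc => ?_⟩
    have h4 : 4 ≤ X := (le_max_right _ _).trans hX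
    have hW := hX₁ X ((le_max_left _ _).trans ((le_max_left _ _).trans hX))
    have := card_le_of_occupancy_le (by linarith) hW hB (by simpa using hocc)
    norm_num at this ⊢
    exact this
  | succ j ih =>
    obtain ⟨δ, C, hδ, hδ2, hC, ih⟩ := ih
    -- The energy bounds give `#B² ≪ X^(1 - δ) * log X` with `log X ≪ X^(δ / 2)`; the square root
    -- has exponent `1 / 2 - δ / 4`. The `10` serves the low-occupancy case.
    refine ⟨δ / 4, max 10 (Real.sqrt (2 * (10 + C) / (δ * c))), by positivity, by linarith,
      by positivity, fun X hX B hB hocc => ?_⟩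
    have h4 : 4 ≤ X := (le_max_right _ _).trans hX
    have hX0 : 0 < X := by linarith
    have hW := hX₁ X ((le_max_left _ _).trans ((le_max_left _ _).trans hX))
    have hE := hX₂ X ((le_max_right _ _).trans ((le_max_left _ _).trans hX)) B hB
    have hpow0 : 0 < X ^ ((1 : ℝ) / 2 - δ / 4) := by positivity
    rcases le_total (occupancy X B) (3 / 8 * totalWeight X) with h | h
    · calc (#B : ℝ) ≤ 10 * X ^ ((9 : ℝ) / 20) := card_le_of_occupancy_le (by linarith) hW hB h
        _ ≤ max 10 (Real.sqrt (2 * (10 + C) / (δ * c))) * X ^ ((1 : ℝ) / 2 - δ / 4) := by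
          refine mul_le_mul (le_max_left _ _) ?_ (by positivity) (by positivity)
          exact Real.rpow_le_rpow_of_exponent_le (by linarith) (by linarith)
    · set H := (diffs B).filter fun h =>
        totalWeight X / 16 ≤ ∑ p ∈ stablePrimes ε X B h, logWeight p with hH
      have hHcard : (#H : ℝ) ≤ 10 * X ^ ((9 : ℝ) / 20) := by
        refine card_le_of_stablePrimes hε h4 hW hB (fun h hh => ?_) fun h hh =>
          (mem_filter.1 hh).2
        obtain ⟨x, hx, rfl⟩ := mem_image.1 (mem_filter.1 hh).1
        rw [mem_product] at hx
        exact hB.abs_sub_le hx.1 hx.2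
      have hHcard' : (#H : ℝ) ≤ 10 * X ^ ((1 : ℝ) / 2 - δ) := by
        refine hHcard.trans ?_
        gcongr
        · linarith
        · linarith
      have hgood : ∀ h ∈ diffs B, h ∉ H →
          (#(interShift B h) : ℝ) ≤ C * X ^ ((1 : ℝ) / 2 - δ) := by
        intro g hg hgH
        have hst : ∑ p ∈ stablePrimes ε X B g, logWeight p ≤ totalWeight X / 16 := by
          by_contra! hlt
          exact hgH (mem_filter.2 ⟨hg, hlt.le⟩)
        -- The intersection is confined as a subset of `B`, and the lost occupancy takes it from
        -- level `j + 1` to level `j`.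
        refine ih X hX _ (hB.mono (filter_subset _ _)) ?_
        refine (occupancy_interShift_le hε h hst).trans ?_
        push_cast at hocc
        linarith
      have hen := energy_le (filter_subset _ _) hgood (by positivity)
      have hlogX : 0 < Real.log X := Real.log_pos (by linarith)
      rcases (Nat.cast_nonneg (α := ℝ) #B).eq_or_lt with h0 | h0
      · rw [← h0]
        positivity
      have hsq : c * (#B : ℝ) ^ 2
          ≤ X ^ ((1 : ℝ) / 2) * Real.log X * ((10 + C) * X ^ ((1 : ℝ) / 2 - δ)) := by
        refine le_of_mul_le_mul_right ?_ (by positivity : (0 : ℝ) < (#B : ℝ) ^ 2)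
        calc c * (#B : ℝ) ^ 2 * (#B : ℝ) ^ 2 = c * (#B : ℝ) ^ 4 := by ring
          _ ≤ X ^ ((1 : ℝ) / 2) * Real.log X
              * ((#H + C * X ^ ((1 : ℝ) / 2 - δ)) * (#B : ℝ) ^ 2) := by
            refine hE.trans ?_
            gcongr
          _ ≤ X ^ ((1 : ℝ) / 2) * Real.log X
              * ((10 * X ^ ((1 : ℝ) / 2 - δ) + C * X ^ ((1 : ℝ) / 2 - δ)) * (#B : ℝ) ^ 2) := by
            gcongr
          _ = _ := by ring
      have hlogle : Real.log X ≤ X ^ (δ / 2) / (δ / 2) :=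
        Real.log_le_rpow_div hX0.le (by positivity)
      have hsq2 : (#B : ℝ) ^ 2
          ≤ 2 * (10 + C) / (δ * c) * (X ^ ((1 : ℝ) / 2 - δ / 4)) ^ 2 := by
        have e : (X ^ ((1 : ℝ) / 2 - δ / 4)) ^ 2
            = X ^ ((1 : ℝ) / 2) * X ^ (δ / 2) * X ^ ((1 : ℝ) / 2 - δ) := by
          rw [← Real.rpow_natCast, ← Real.rpow_mul hX0.le, ← Real.rpow_add hX0,
            ← Real.rpow_add hX0]
          congr 1
          push_cast
          ring
        rw [e]
        refine le_of_mul_le_mul_left ?_ hc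
        refine hsq.trans ?_
        calc X ^ ((1 : ℝ) / 2) * Real.log X * ((10 + C) * X ^ ((1 : ℝ) / 2 - δ))
            ≤ X ^ ((1 : ℝ) / 2) * (X ^ (δ / 2) / (δ / 2))
              * ((10 + C) * X ^ ((1 : ℝ) / 2 - δ)) := by gcongr
          _ = _ := by field_simp
      have hfin : (#B : ℝ)
          ≤ Real.sqrt (2 * (10 + C) / (δ * c)) * X ^ ((1 : ℝ) / 2 - δ / 4) := by
        refine le_of_sq_le_sq ?_ (by positivity)
        rw [mul_pow, Real.sq_sqrt (by positivity)]
        exact hsq2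
      exact hfin.trans (mul_le_mul_of_nonneg_right (le_max_right _ _) hpow0.le)

/-- Confined sets are smaller than the square-root bound by a power. -/
theorem exists_card_confined_le {ε : ℝ} (hε : 0 < ε) :
    ∃ δ : ℝ, 0 < δ ∧ ∃ C : ℝ, 0 < C ∧ ∀ X : ℝ, 1 ≤ X → ∀ B : Finset ℤ, Confined ε X B →
      (#B : ℝ) ≤ C * X ^ ((1 : ℝ) / 2 - δ) := by
  obtain ⟨X₀, h⟩ := exists_card_le_of_occupancy hε
  -- With this many increments the threshold exceeds the total weight, so every confined set
  -- qualifies.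
  obtain ⟨j, hj⟩ := exists_nat_ge (1 / (ε / 8000 / 16))
  rw [div_le_iff₀ (by positivity)] at hj
  obtain ⟨δ, C, hδ, hδ2, hC, hbound⟩ := h j
  -- The `X₀` covers `X ≤ X₀`, where the trivial bound `#B ≤ X` is enough.
  refine ⟨δ, hδ, max C X₀, lt_max_of_lt_left hC, fun X hX B hB => ?_⟩
  have hpow : 1 ≤ X ^ ((1 : ℝ) / 2 - δ) := Real.one_le_rpow hX (by linarith)
  rcases le_total X₀ X with hle | hle
  · refine (hbound X hle B hB ((occupancy_le_totalWeight X B).trans ?_)).trans ?_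
    · exact le_mul_of_one_le_left (totalWeight_nonneg X) (by linarith)
    · gcongr
      exact le_max_left _ _
  · calc (#B : ℝ) ≤ X := hB.card_le (by linarith)
      _ ≤ max C X₀ := hle.trans (le_max_right _ _)
      _ ≤ max C X₀ * X ^ ((1 : ℝ) / 2 - δ) :=
        le_mul_of_one_le_right (hC.le.trans (le_max_left _ _)) hpow

theorem theorem1p3 :
    ∀ ε : ℝ, 0 < ε →
      ∃ ε' : ℝ, 0 < ε' ∧ ∃ C : ℝ, 0 < C ∧
        ∀ X : ℝ, 1 ≤ X → ∀ A : Set ℤ,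
          (∀ p : ℕ, p.Prime → (p : ℝ) ≤ X ^ ((1 : ℝ) / 2) →
            ∃ (a d : ZMod p) (L : ℕ), (L : ℝ) ≤ (1 - ε) * (p : ℝ) ∧
              reduceMod A p ⊆ arithProg a d L) →
          ((initialPart A X).ncard : ℝ) ≤ C * X ^ ((1 : ℝ) / 2 - ε') := by
  intro ε hε
  obtain ⟨δ, hδ, C, hC, h⟩ := exists_card_confined_le hε
  refine ⟨δ, hδ, C, hC, fun X hX A hA => ?_⟩
  have hfin : (initialPart A X).Finite := by
    refine (Set.finite_Icc (1 : ℤ) ⌊X⌋).subset fun n hn => ?_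
    exact ⟨hn.2.1, Int.le_floor.2 hn.2.2⟩
  rw [Set.ncard_eq_toFinset_card _ hfin]
  refine h X hX _ ⟨fun n hn => ((hfin.mem_toFinset).1 hn).2, fun p hp hpX => ?_⟩
  obtain ⟨a, d, L, hL, hsub⟩ := hA p hp hpX
  exact ⟨a, d, L, hL, fun n hn => hsub ⟨n, ((hfin.mem_toFinset).1 hn).1, rfl⟩⟩
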